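/- Fix $\sigma>0$ and the kernel $C(\Delta)=e^{-|\Delta|/\sigma}$. **Setting.** Let $P=(P_{ij})$ be a real matrix of co-occurrence weights on a finite vocabulary $V$, let $P_i=\sum_j P_{ij}$, and let $M_{ij}=\dfrac{P_{ij}-P_iP_j}{\frac12(P_{ij}+P_iP_j)}$ be the normalized co-occurrence matrix. Let $S\subseteq V$ be a set of $L$ words, in bijection $i\mapsto n_i$ with the centered index set $\{-\frac L2,\dots,\frac L2-1\}$ ($L$ even) or $\{-\frac{L-1}2,\dots,\frac{L-1}2\}$ ($L$ odd), with coordinates $x_i=2n_i/L$. Assume one of the following. (a) $P_i>0$ for $i\in S$, and $P_{ij}=P_iP_j\tilde C(|x_i-x_j|)$ for $i,j\in S$, where $2(\tilde C-1)/(\tilde C+1)=C$ at the occurring distances; and $M\succeq 0$. (b) $M=M^+-M^-$ with $M^\pm\succeq0$, $M^+M^-=0$, $M^\pm_{ij}=C^\pm(|x_i-x_j|)$ for $i,j\in S$, and $C^++C^-=C$ at the occurring distances. Let $d\ge\operatorname{rank}M$, and let $W\in\mathbb R^{V\times d}$ be the word embeddings $W_{i\mu}=\Phi_{i\mu}\sqrt{|\Lambda_{\mu\mu}|}$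 from an eigendecomposition $M=\Phi\Lambda\Phi^\top$ with eigenvalues of non-increasing magnitude (zero columns if $d>|V|$), up to a right orthogonal transformation. Let $W_S$ be the rows of $W$ in $S$, centered to mean zero, with compact singular value decomposition $W_S=\Psi D U^\top$ (singular values non-increasing, $\min(L,d)$ columns), and let $\overline W=W_SU=\Psi D$ be the PCA-projected embeddings. **Claim.** For each $\mu\ge1$ there is a unique $k_\mu>0$ with $$k_\mu=\begin{cases}\dfrac{(\mu+1)\pi}2-\arctan(\sigma k_\mu),&\mu\text{ odd},\\[2mm] \dfrac{\mu\pi}2+\arctan\!\Big(\dfrac{k_\mu}{1+\sigma(1+\sigma)k_\mu^2}\Big),&\mu\text{ even}.\end{cases}$$ These satisfy $k_\mu<k_{\mu+1}$, $\tan k_\mu=-\sigma k_\mu$ for odd $\mu$, and $\tan k_\mu=\dfrac{k_\mu}{1+\sigma(1+\sigma)k_\mu^2}$ for even $\mu$. Put $\phi_\mu(x)=\sin(k_\mu x)$ for odd $\mu$, $\phi_\mu(x)=\cos(k_\mu x)-\frac{\sin k_\mu}{k_\mu}$ for even $\mu$, $$N_\mu=\begin{cases}\sqrt{\frac12-\frac{\sin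 2k_\mu}{4k_\mu}},&\mu\text{ odd},\\ \sqrt{\frac12+\frac{\sin 2k_\mu}{4k_\mu}-\big(\frac{\sin k_\mu}{k_\mu}\big)^2},&\mu\text{ even},\end{cases}\qquad a_\mu=\sqrt{\frac{2\sigma}{1+\sigma^2k_\mu^2}}.$$ Then $N_\mu>0$, $a_\mu>0$, $\int_{-1}^1\phi_\mu=0$ and $\frac12\int_{-1}^1\phi_\mu^2=N_\mu^2$. Moreover, for each fixed $\mu$, as $L\to\infty$, the $\mu$-th column of $\overline W$ exists for all large $L$ and, up to a sign $s\in\{1,-1\}$ of that column (which may depend on $L$ and on the choices, but not on $i$), $$\sqrt L\,\Big(\sqrt{2/L}\;\overline W_{i\mu}\Big)-s\,a_\mu\,\frac{\phi_\mu(x_i)}{N_\mu}\longrightarrow 0$$ uniformly in $i\in S$ and in all the data $V,P,S,n,d,W,\overline W$ as above; and the $\mu$-th singular value of $\sqrt{2/L}\,\overline W$, that is, the Euclidean norm of its $\mu$-th column, tends to $a_\mu$. (Equivalently, $\overline W_{i\mu}-s\,a_\mu\phi_\mu(x_i)/(\sqrt2N_\mu)\to0$, where $\phi_\mu/(\sqrt2N_\mu)$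 has unit norm in $L^2([-1,1])$.) -/

import Mathlib

open Matrix

/-- Unigram weights `P_i = ∑_j P_ij` of a co-occurrence matrix. -/
def unigram {V : Type*} [Fintype V] (P : Matrix V V ℝ) (i : V) : ℝ :=
  ∑ j, P i j

/-- The normalized co-occurrence matrix
`M_ij = (P_ij - P_i P_j) / ((P_ij + P_i P_j) / 2)`. -/
noncomputable def normalizedCooccurrence {V : Type*} [Fintype V] (P : Matrix V V ℝ) :
    Matrix V V ℝ :=
  Matrix.of fun i j =>
    (P i j - unigram P i * unigram P j) / ((1 / 2) * (P i j + unigram P i * unigram P j))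

/-- Centered index set of the one-dimensional lattice with `L` sites. -/
def centeredIndexSet (L : ℕ) : Set ℤ :=
  if Even L then Set.Icc (-((L : ℤ) / 2)) ((L : ℤ) / 2 - 1)
  else Set.Icc (-(((L : ℤ) - 1) / 2)) (((L : ℤ) - 1) / 2)

/-- The coordinate in `[-1, 1]` of the site with lattice index `n`. -/
noncomputable def latticeCoord (L : ℕ) (n : ℤ) : ℝ :=
  2 * (n : ℝ) / (L : ℝ)

/-- Translation symmetry of the co-occurrence statistics on `S` with kernel `C`:
`P_ij = P_i P_j D(|x_i - x_j|)` for words of `S`, where the kernel is `C = f ∘ D` with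
`f y = 2 (y - 1) / (y + 1)`, and the normalized co-occurrence matrix is positive semidefinite. -/
structure TranslationSymmetric {V : Type*} [Fintype V] (P : Matrix V V ℝ) (S : Finset V)
    (x : V → ℝ) (C : ℝ → ℝ) : Prop where
  unigram_pos : ∀ i ∈ S, 0 < unigram P i
  exists_kernel : ∃ D : ℝ → ℝ, ∀ i ∈ S, ∀ j ∈ S,
    P i j = unigram P i * unigram P j * D |x i - x j| ∧
      2 * (D |x i - x j| - 1) / (D |x i - x j| + 1) = C |x i - x j|
  posSemidef : (normalizedCooccurrence P).PosSemidef

/-- Translation symmetry of the matrix absolute value: with `M = M⁺ - M⁻` the decomposition of the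
normalized co-occurrence matrix into positive semidefinite parts with `M⁺ M⁻ = 0`, both parts are
translation symmetric on `S`, and `C` is the resulting kernel of `|M| = M⁺ + M⁻`. -/
def AbsTranslationSymmetric {V : Type*} [Fintype V] (P : Matrix V V ℝ) (S : Finset V)
    (x : V → ℝ) (C : ℝ → ℝ) : Prop :=
  ∃ (Mp Mm : Matrix V V ℝ) (Cp Cm : ℝ → ℝ),
    Mp.PosSemidef ∧ Mm.PosSemidef ∧ normalizedCooccurrence P = Mp - Mm ∧ Mp * Mm = 0 ∧
    ∀ i ∈ S, ∀ j ∈ S,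
      Mp i j = Cp |x i - x j| ∧ Mm i j = Cm |x i - x j| ∧
        Cp |x i - x j| + Cm |x i - x j| = C |x i - x j|

/-- `W` is the matrix of `d`-dimensional word embeddings determined by the symmetric matrix `M`:
if `M = Φ Λ Φᵀ` is an eigendecomposition with eigenvalues of non-increasing magnitude, then
`W_iμ = Φ_iμ √|Λ_μ|` for `μ < d` (columns beyond the size of the vocabulary vanish), up to a right
orthogonal transformation `Q`. -/
def IsWordEmbedding {V : Type*} [Fintype V] (M : Matrix V V ℝ) (d : ℕ)
    (W : Matrix V (Fin d) ℝ) : Prop :=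
  ∃ (Φ : Matrix V (Fin (Fintype.card V)) ℝ) (Λ : Fin (Fintype.card V) → ℝ)
    (Q : Matrix (Fin d) (Fin d) ℝ),
    Φᵀ * Φ = 1 ∧ M = Φ * Matrix.diagonal Λ * Φᵀ ∧ (Antitone fun m => |Λ m|) ∧ Q * Qᵀ = 1 ∧
    W = (Matrix.of fun (i : V) (m : Fin d) =>
      if h : (m : ℕ) < Fintype.card V then Φ i ⟨m, h⟩ * √|Λ ⟨m, h⟩| else 0) * Q

/-- The mean-centering matrix `I - n⁻¹ 1 1ᵀ`. -/
noncomputable def centeringMatrix (ι : Type*) [Fintype ι] [DecidableEq ι] : Matrix ι ι ℝ :=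
  1 - (Fintype.card ι : ℝ)⁻¹ • Matrix.of fun _ _ => (1 : ℝ)

/-- The centered embeddings of the words in `S`. -/
noncomputable def centeredEmbedding {V : Type*} [DecidableEq V] {d : ℕ}
    (S : Finset V) (W : Matrix V (Fin d) ℝ) : Matrix S (Fin d) ℝ :=
  centeringMatrix S * W.submatrix (fun i : S => (i : V)) id

/-- `B` is the PCA projection of `A`: for a compact singular value decomposition `A = Φ diag(s) Uᵀ`
with singular values in non-increasing order, `B = A U = Φ diag(s)`. -/
def IsPCAProjection {ι : Type*} [Fintype ι] {d : ℕ} (A : Matrix ι (Fin d) ℝ)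
    (B : Matrix ι (Fin (min (Fintype.card ι) d)) ℝ) : Prop :=
  ∃ (Φ : Matrix ι (Fin (min (Fintype.card ι) d)) ℝ) (s : Fin (min (Fintype.card ι) d) → ℝ)
    (U : Matrix (Fin d) (Fin (min (Fintype.card ι) d)) ℝ),
    Φᵀ * Φ = 1 ∧ Uᵀ * U = 1 ∧ (∀ m, 0 ≤ s m) ∧ Antitone s ∧
    A = Φ * Matrix.diagonal s * Uᵀ ∧ B = A * U

/-- Right-hand side of the self-consistent quantization condition of the mode `μ`. -/
noncomputable def quantizationRHS (σ : ℝ) (μ : ℕ) (k : ℝ) : ℝ :=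
  if Odd μ then ((μ : ℝ) + 1) * Real.pi / 2 - Real.arctan (σ * k)
  else (μ : ℝ) * Real.pi / 2 + Real.arctan (k / (1 + σ * (1 + σ) * k ^ 2))

/-- The (unnormalized, mean-zero) mode `μ` with wavenumber `k`. -/
noncomputable def centeredMode (μ : ℕ) (k x : ℝ) : ℝ :=
  if Odd μ then Real.sin (k * x) else Real.cos (k * x) - Real.sin k / k

/-- The normalization of the mode `μ` with wavenumber `k`. -/
noncomputable def modeNorm (μ : ℕ) (k : ℝ) : ℝ :=
  if Odd μ then √(1 / 2 - Real.sin (2 * k) / (4 * k))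
  else √(1 / 2 + Real.sin (2 * k) / (4 * k) - (Real.sin k / k) ^ 2)

/-- The amplitude of a mode with wavenumber `k`. -/
noncomputable def modeAmplitude (σ k : ℝ) : ℝ :=
  √(2 * σ / (1 + σ ^ 2 * k ^ 2))

/-!
The centered Gram matrix of the embeddings is diagonalized exactly, for every lattice size `L`, and
the limit `L → ∞` is taken in explicit formulas.

Since `d ≥ rank M`, the Gram matrix `W Wᵀ` is the absolute value of `M`
(`IsWordEmbedding.mul_transpose`, by uniqueness of positive semidefinite square roots), so its
restriction to `S` is the matrix `ρ ^ |i - j|` with `ρ = exp (-2 / (σ L))`. A sine or cosine of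
frequency `2 θ / L` around the midpoint of the lattice is mapped by this matrix to a multiple of
itself plus two boundary terms (`sum_pow_mul_of_recurrence`). For a sine the boundary terms vanish,
and for a mean-zero cosine they combine to a constant, which centering removes, as soon as `θ` is a
zero of `quantizationDefect` (`exists_sum_latticeMode_eq`). There is such a zero in
`(m π / 2, (m + 1) π / 2)` for every `1 ≤ m < L` (`exists_quantizationDefect_eq_zero`). The
eigenvalue `toeplitzSymbol` decreases with the frequency, so these `L - 1` modes and the constant
vector are a complete system with simple, ordered eigenvalues. The singular value decomposition
therefore has to list the modes in the order of `m` (`eigen_matching`), which determines the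
columns of the PCA projection up to signs (`IsPCAProjection.exists_column_eq_latticeMode`).

As `L → ∞`, the rescaled defect converges to a nonvanishing multiple of the sine of
`quantizationPhase`, a strictly increasing function that is a multiple of `π` exactly where the
quantization condition holds. Hence the limiting defect changes sign at `k_μ`
(`limitDefect_mul_neg`), and `θ` can be taken arbitrarily close to `k_μ` for large `L`
(`eventually_exists_quantizationDefect_eq_zero`). The eigenvalue, the norm of the mode and the mode
itself then converge, the latter uniformly on the lattice (`tendsto_toeplitzSymbol`,
`tendsto_sum_latticeMode_sq`, `abs_latticeMode_sub_centeredMode_le`).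
-/

/-! ### Word embeddings and their Gram matrix -/

open scoped MatrixOrder in
theorem posSemidef_eq_of_mul_self_eq {ι : Type*} [Fintype ι] [DecidableEq ι]
    {A B : Matrix ι ι ℝ} (hA : A.PosSemidef) (hB : B.PosSemidef) (h : A * A = B * B) : A = B := by
  exact (CFC.sqrt_unique h hA.nonneg).symm.trans (CFC.sqrt_unique rfl hB.nonneg)

/-- In the positive semidefinite case, `M⁺ = M` and `M⁻ = 0`. -/
theorem TranslationSymmetric.abs {V : Type*} [Fintype V] {P : Matrix V V ℝ} {S : Finset V}
    {x : V → ℝ} {C : ℝ → ℝ} (h : TranslationSymmetric P S x C) :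
    AbsTranslationSymmetric P S x C := by
  obtain ⟨D, hD⟩ := h.exists_kernel
  refine ⟨normalizedCooccurrence P, 0, C, 0, h.posSemidef, PosSemidef.zero, by simp, by simp,
    fun i hi j hj => ⟨?_, rfl, by simp⟩⟩
  obtain ⟨h1, h2⟩ := hD i hi j hj
  have hp : unigram P i * unigram P j ≠ 0 :=
    (mul_pos (h.unigram_pos i hi) (h.unigram_pos j hj)).ne'
  rw [← h2]
  simp only [normalizedCooccurrence, of_apply, h1]
  rw [← mul_div_mul_left (2 * (D |x i - x j| - 1)) _ (mul_ne_zero (half_pos one_pos).ne' hp)]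
  congr 1 <;> ring

/-- As soon as the embedding dimension is at least the rank of `M`, the Gram matrix of the word
embeddings is the matrix absolute value of `M`. -/
theorem IsWordEmbedding.mul_transpose {V : Type*} [Fintype V] [DecidableEq V]
    {M Mp Mm : Matrix V V ℝ} {d : ℕ} {W : Matrix V (Fin d) ℝ} (h : IsWordEmbedding M d W)
    (hd : M.rank ≤ d) (hp : Mp.PosSemidef) (hm : Mm.PosSemidef) (hM : M = Mp - Mm)
    (h0 : Mp * Mm = 0) : W * Wᵀ = Mp + Mm := by
  obtain ⟨Φ, Λ, Q, hΦ, hΛ, hanti, hQ, rfl⟩ := h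
  have hΛ0 : ∀ m : Fin (Fintype.card V), d ≤ m → Λ m = 0 := by
    intro m hdm
    by_contra hne
    have hdiag : diagonal Λ = Φᵀ * M * Φ := by
      rw [hΛ, Matrix.mul_assoc, Matrix.mul_assoc, hΦ, Matrix.mul_one, ← Matrix.mul_assoc, hΦ,
        Matrix.one_mul]
    have hr : (diagonal Λ).rank ≤ M.rank := by
      rw [hdiag]
      exact (rank_mul_le_left _ _).trans (rank_mul_le_right _ _)
    -- all the eigenvalues up to the index `m` are nonzero, so the rank is at least `m + 1`
    rw [rank_diagonal, Fintype.card_subtype] at hr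
    have hsub : Finset.Iic m ⊆ Finset.univ.filter fun i => Λ i ≠ 0 := fun i hi => by
      simpa using fun h0 : Λ i = 0 => hne (by
        simpa [h0] using hanti (Finset.mem_Iic.1 hi))
    have hcard := Finset.card_le_card hsub
    rw [Fin.card_Iic] at hcard
    omega
  have hN : (Φ * diagonal (fun m => |Λ m|) * Φᵀ).PosSemidef := by
    have : (diagonal (fun m => |Λ m|)).PosSemidef := PosSemidef.diagonal fun m => abs_nonneg _
    simpa using this.mul_mul_conjTranspose_same Φ
  have hsq : (Φ * diagonal (fun m => |Λ m|) * Φᵀ) * (Φ * diagonal (fun m => |Λ m|) * Φᵀ)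
      = M * M := by
    have key : ∀ D : Matrix (Fin (Fintype.card V)) (Fin (Fintype.card V)) ℝ,
        (Φ * D * Φᵀ) * (Φ * D * Φᵀ) = Φ * (D * D) * Φᵀ := fun D => by
      calc _ = Φ * D * (Φᵀ * Φ) * D * Φᵀ := by simp only [Matrix.mul_assoc]
        _ = _ := by rw [hΦ]; simp only [Matrix.mul_assoc, Matrix.mul_one]
    rw [hΛ, key, key, diagonal_mul_diagonal, diagonal_mul_diagonal]
    simp only [abs_mul_abs_self]
  have h0' : Mm * Mp = 0 := by
    have := congrArg Matrix.transpose h0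
    rwa [transpose_mul, transpose_zero, ← conjTranspose_eq_transpose_of_trivial,
      ← conjTranspose_eq_transpose_of_trivial, hp.1.eq, hm.1.eq] at this
  rw [← posSemidef_eq_of_mul_self_eq hN (hp.add hm) (hsq.trans (by
    rw [hM]; simp only [Matrix.mul_sub, Matrix.sub_mul, Matrix.mul_add, Matrix.add_mul, h0, h0']
    simp)), transpose_mul, Matrix.mul_assoc, ← Matrix.mul_assoc Q, hQ, Matrix.one_mul]
  ext i j
  set g : ℕ → ℝ := fun m => if h : m < Fintype.card V then
    Φ i ⟨m, h⟩ * |Λ ⟨m, h⟩| * Φ j ⟨m, h⟩ else 0 with hg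
  have h1 : (Φ * diagonal (fun m => |Λ m|) * Φᵀ) i j
      = ∑ m ∈ Finset.range (Fintype.card V), g m := by
    rw [← Fin.sum_univ_eq_sum_range, mul_apply]
    exact Finset.sum_congr rfl fun m _ => by simp [hg, mul_diagonal]
  have h2 : ∀ m, d ≤ m → g m = 0 := fun m hm => by
    by_cases h : m < Fintype.card V
    · simp [hg, h, hΛ0 ⟨m, h⟩ hm]
    · simp [hg, h]
  have h3 : ∀ m, Fintype.card V ≤ m → g m = 0 := fun m hm => by simp [hg, not_lt.2 hm]
  trans ∑ m ∈ Finset.range d, g m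
  · rw [← Fin.sum_univ_eq_sum_range, mul_apply]
    refine Finset.sum_congr rfl fun m _ => ?_
    by_cases h : (m : ℕ) < Fintype.card V
    · simp only [of_apply, transpose_apply, h, dif_pos, hg]
      nth_rw 3 [← Real.mul_self_sqrt (abs_nonneg (Λ ⟨m, h⟩))]
      ring
    · simp [h, hg]
  · rw [h1]
    rcases le_total d (Fintype.card V) with h | h
    · exact Finset.sum_subset (by simpa using h) fun m _ hm => h2 m (by simpa using hm)
    · exact (Finset.sum_subset (by simpa using h) fun m _ hm => h3 m (by simpa using hm)).symm

/-! ### PCA projections with a known spectrum -/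

/-- Eigenvectors for `r + 1` strictly decreasing eigenvalues, all but possibly the last nonzero,
pin down a compact spectral decomposition `Φ diag(t) Φᵀ` with `t` non-increasing: every such
eigenvalue occurs among the `t j`, in the same order, and there is no room for further ones. If
`p ≤ r`, only the first `r` eigenvalues need to occur. -/
theorem eigen_matching {ι : Type*} [Fintype ι] [DecidableEq ι] {p r : ℕ}
    (hι : Fintype.card ι = r + 1) (hp : p ≤ r + 1)
    {Φ : Matrix ι (Fin p) ℝ} {t : Fin p → ℝ} (hΦ : Φᵀ * Φ = 1) (ht : Antitone t)
    {v : Fin (r + 1) → ι → ℝ} {l : Fin (r + 1) → ℝ} (hl : StrictAnti l)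
    (hl0 : ∀ m : Fin (r + 1), m ≠ Fin.last r → l m ≠ 0) (hv : ∀ m, v m ≠ 0)
    (hG : ∀ m, (Φ * diagonal t * Φᵀ) *ᵥ v m = l m • v m) (m : Fin (r + 1))
    (hm : m ≠ Fin.last r) :
    ∃ h : (m : ℕ) < p, t ⟨m, h⟩ = l m ∧ ∃ c : ℝ, ∀ i, v m i = c * Φ i ⟨m, h⟩ := by
  have hw : ∀ m j, t j * (Φᵀ *ᵥ v m) j = l m * (Φᵀ *ᵥ v m) j := by
    intro m j
    have := congrArg (fun u => (Φᵀ *ᵥ u) j) (hG m)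
    simp only [mulVec_mulVec, ← Matrix.mul_assoc, hΦ, Matrix.one_mul] at this
    rw [← mulVec_mulVec, mulVec_diagonal, mulVec_smul] at this
    exact this
  have hrange : ∀ m, (l m ≠ 0 ∨ p = r + 1) → Φ *ᵥ (Φᵀ *ᵥ v m) = v m := by
    rintro m (h | h)
    · have h1 := hG m
      rw [← mulVec_mulVec, ← mulVec_mulVec,
        show diagonal t *ᵥ (Φᵀ *ᵥ v m) = l m • (Φᵀ *ᵥ v m) by
          ext j; rw [mulVec_diagonal, hw]; rfl, mulVec_smul] at h1
      exact smul_right_injective _ h h1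
    · rw [mulVec_mulVec, (mul_eq_one_comm_of_card_eq _ _ _ (by simp [hι, h])).1 hΦ, one_mulVec]
  have hex : ∀ m, (l m ≠ 0 ∨ p = r + 1) → ∃ j, t j = l m := by
    intro m h
    have h1 : Φᵀ *ᵥ v m ≠ 0 := fun h0 => hv m (by rw [← hrange m h, h0, mulVec_zero])
    obtain ⟨j, hj⟩ := Function.ne_iff.1 h1
    exact ⟨j, mul_right_cancel₀ hj (hw m j)⟩
  have hlt : ∀ {m m' j j'}, t j = l m → t j' = l m' → m < m' → j < j' := by
    intro m m' j j' h h' hmm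
    by_contra hj
    have := ht (not_lt.1 hj)
    rw [h, h'] at this
    exact absurd this (not_le.2 (hl hmm))
  have hid : ∃ h : (m : ℕ) < p, ∀ j, t j = l m → j = ⟨m, h⟩ := by
    -- `N` is the last index whose eigenvalue is known to occur among the `t j`
    obtain ⟨N, hmN, hNr, hpN, hval⟩ : ∃ N : ℕ, (m : ℕ) ≤ N ∧ N ≤ r ∧ p ≤ N + 1 ∧
        ∀ m' : Fin (r + 1), (m' : ℕ) ≤ N → ∃ j, t j = l m' := by
      have hmr : (m : ℕ) ≠ r := fun h => hm (Fin.ext h)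
      by_cases h : p = r + 1
      · exact ⟨r, by omega, le_rfl, hp, fun m' _ => hex m' (Or.inr h)⟩
      · refine ⟨r - 1, by omega, by omega, by omega, fun m' h' => hex m' (Or.inl (hl0 m' ?_))⟩
        rintro rfl
        simp only [Fin.val_last] at h'
        omega
    have hlow : ∀ k (hk : k < r + 1), k ≤ N → ∀ j, t j = l ⟨k, hk⟩ → k ≤ (j : ℕ) := by
      intro k
      induction k with
      | zero => intros; omega
      | succ k ih =>
        intro hk hkN j hj
        obtain ⟨j', hj'⟩ := hval ⟨k, by omega⟩ (by simp only; omega)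
        have h1 := ih (by omega) (by omega) j' hj'
        have h2 := hlt hj' hj (by simp)
        rw [Fin.lt_def] at h2
        omega
    have hupp : ∀ k k' (hk : k' < r + 1), k' + k = N → ∀ j, t j = l ⟨k', hk⟩ →
        (j : ℕ) + k < p := by
      intro k
      induction k with
      | zero => intro _ _ _ j _; exact j.2
      | succ k ih =>
        intro k' hk hkN j hj
        obtain ⟨j', hj'⟩ := hval ⟨k' + 1, by omega⟩ (by simp only; omega)
        have h1 := ih (k' + 1) (by omega) (by omega) j' hj'
        have h2 := hlt hj hj' (by simp)
        rw [Fin.lt_def] at h2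
        omega
    have hfin : ∀ j, t j = l m → (j : ℕ) = m := fun j hj => by
      have h1 := hlow m m.2 hmN j hj
      have h2 := hupp (N - m) m m.2 (by omega) j hj
      omega
    obtain ⟨j, hj⟩ := hval m hmN
    exact ⟨hfin j hj ▸ j.2, fun j' hj' => Fin.ext (hfin j' hj')⟩
  obtain ⟨h, hj⟩ := hid
  have hlm := hl0 m hm
  refine ⟨h, ?_, (Φᵀ *ᵥ v m) ⟨m, h⟩, fun i => ?_⟩
  · obtain ⟨j, hj'⟩ := hex m (Or.inl hlm)
    rwa [← hj j hj']
  · conv_lhs => rw [← hrange m (Or.inl hlm)]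
    rw [mulVec, dotProduct, Finset.sum_eq_single ⟨(m : ℕ), h⟩, mul_comm]
    · intro j _ hne
      have : (Φᵀ *ᵥ v m) j = 0 := by
        by_contra h0
        exact hne (hj j (mul_right_cancel₀ h0 (hw m j)))
      rw [this, mul_zero]
    · simp

theorem centeringMatrix_mulVec {ι : Type*} [Fintype ι] [DecidableEq ι] (v : ι → ℝ) (i : ι) :
    (centeringMatrix ι *ᵥ v) i = v i - (Fintype.card ι : ℝ)⁻¹ * ∑ j, v j := by
  rw [centeringMatrix, sub_mulVec, one_mulVec, smul_mulVec]
  simp [mulVec, dotProduct]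

theorem centeringMatrix_transpose {ι : Type*} [Fintype ι] [DecidableEq ι] :
    (centeringMatrix ι)ᵀ = centeringMatrix ι := by
  ext i j
  simp [centeringMatrix, one_apply, eq_comm]

/-- A mean-zero vector that a matrix maps to a multiple of itself up to a constant is an
eigenvector of the doubly centered matrix. -/
theorem centeringMatrix_mul_mul_mulVec {ι : Type*} [Fintype ι] [DecidableEq ι]
    {K : Matrix ι ι ℝ} {v : ι → ℝ} {l c : ℝ} (h0 : ∑ i, v i = 0)
    (h : ∀ i, ∑ j, K i j * v j = l * v i + c) :
    (centeringMatrix ι * K * centeringMatrix ι) *ᵥ v = l • v := by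
  have h1 : centeringMatrix ι *ᵥ v = v := by
    ext i; rw [centeringMatrix_mulVec, h0, mul_zero, sub_zero]
  rw [← mulVec_mulVec, h1, ← mulVec_mulVec]
  ext i
  have : Nonempty ι := ⟨i⟩
  have hc : (Fintype.card ι : ℝ) ≠ 0 := by exact_mod_cast Fintype.card_ne_zero
  have h2 : K *ᵥ v = fun i => l * v i + c := funext h
  rw [centeringMatrix_mulVec, h2]
  simp only [Finset.sum_add_distrib, ← Finset.mul_sum, h0, Finset.sum_const, Finset.card_univ,
    nsmul_eq_mul, Pi.smul_apply, smul_eq_mul]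
  field_simp
  ring

/-- If the Gram matrix `A Aᵀ` has a known simple spectrum, the columns of a PCA projection of `A`
are, up to signs, the normalized eigenvectors scaled by the square roots of the eigenvalues. -/
theorem IsPCAProjection.exists_column_eq {ι : Type*} [Fintype ι] [DecidableEq ι] {d r : ℕ}
    {A : Matrix ι (Fin d) ℝ} {B : Matrix ι (Fin (min (Fintype.card ι) d)) ℝ}
    (hB : IsPCAProjection A B) (hι : Fintype.card ι = r + 1)
    {v : Fin (r + 1) → ι → ℝ} {l : Fin (r + 1) → ℝ} (hl : StrictAnti l)
    (hl0 : ∀ m : Fin (r + 1), m ≠ Fin.last r → l m ≠ 0) (hv : ∀ m, v m ≠ 0)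
    (hG : ∀ m, (A * Aᵀ) *ᵥ v m = l m • v m) (m : Fin (r + 1)) (hm : m ≠ Fin.last r) :
    ∃ (h : (m : ℕ) < min (Fintype.card ι) d) (s : ℝ), (s = 1 ∨ s = -1) ∧
      (∀ i, B i ⟨m, h⟩ = s * (√(l m) * (v m i / √(∑ i, v m i ^ 2)))) ∧
      ∑ i, B i ⟨m, h⟩ ^ 2 = l m := by
  obtain ⟨Φ, s, U, hΦ, hU, hs, hanti, hA, rfl⟩ := hB
  have hGram : A * Aᵀ = Φ * diagonal (fun m => s m ^ 2) * Φᵀ := by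
    calc A * Aᵀ = Φ * diagonal s * (Uᵀ * U) * diagonal s * Φᵀ := by
          rw [hA]; simp only [transpose_mul, transpose_transpose, diagonal_transpose,
            Matrix.mul_assoc]
      _ = _ := by
          rw [hU, Matrix.mul_one, Matrix.mul_assoc Φ, diagonal_mul_diagonal]
          simp only [sq]
  have hBΦ : ∀ i j, (A * U) i j = Φ i j * s j := by
    intro i j
    rw [hA, Matrix.mul_assoc, hU, Matrix.mul_one, mul_diagonal]
  have ht : Antitone fun m => s m ^ 2 := fun a b h => pow_le_pow_left₀ (hs b) (hanti h) 2
  rw [hGram] at hG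
  obtain ⟨h, hsl, c, hc⟩ := eigen_matching hι (by omega) hΦ ht hl hl0 hv hG m hm
  have hsum : ∑ i, Φ i ⟨m, h⟩ ^ 2 = 1 := by
    have := congrFun (congrFun hΦ ⟨m, h⟩) ⟨m, h⟩
    rw [mul_apply, one_apply_eq] at this
    simpa [sq] using this
  have hc0 : c ≠ 0 := by
    rintro rfl
    exact hv m (funext fun i => by simp [hc i])
  have hnorm : √(∑ i, v m i ^ 2) = |c| := by
    simp only [hc, mul_pow, ← Finset.mul_sum, hsum, mul_one, Real.sqrt_sq_eq_abs]
  have hsm : √(l m) = s ⟨m, h⟩ := by rw [← hsl, Real.sqrt_sq (hs _)]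
  refine ⟨h, |c| / c, ?_, fun i => ?_, ?_⟩
  · rcases abs_choice c with h | h <;> rw [h]
    · exact Or.inl (div_self hc0)
    · exact Or.inr (by field_simp)
  · rw [hBΦ, hnorm, hsm, hc]
    have := abs_ne_zero.2 hc0
    field_simp
  · simp only [hBΦ, mul_pow, ← Finset.sum_mul, hsum, one_mul, hsl]

theorem exists_Ioo_eq_zero {f : ℝ → ℝ} (hf : Continuous f) {a b : ℝ} (hab : a < b)
    (h : f a * f b < 0) : ∃ x ∈ Set.Ioo a b, f x = 0 := by
  rcases mul_neg_iff.1 h with ⟨h1, h2⟩ | ⟨h1, h2⟩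
  · exact intermediate_value_Ioo' hab.le hf.continuousOn ⟨h2, h1⟩
  · exact intermediate_value_Ioo hab.le hf.continuousOn ⟨h1, h2⟩

/-! ### Diagonalization of the centered exponential kernel on the lattice -/

/-- The eigenvalue `∑_{n ∈ ℤ} ρ ^ |n| cos (2 δ n)` of the bi-infinite Toeplitz matrix with entries
`ρ ^ |i - j|` at the frequency `2 δ`. -/
noncomputable def toeplitzSymbol (ρ δ : ℝ) : ℝ :=
  (1 - ρ ^ 2) / ((1 - ρ) ^ 2 + 4 * ρ * Real.sin δ ^ 2)

/-- The mode number `m` of a lattice with `L` sites, at the site `t ∈ {0, …, L - 1}`: a sine or a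
cosine of frequency `2 θ / L` around the midpoint of the lattice, made mean-zero. -/
noncomputable def latticeMode (L m : ℕ) (θ t : ℝ) : ℝ :=
  if Odd m then Real.sin (2 * (θ / L) * t - (L - 1) * (θ / L))
  else Real.cos (2 * (θ / L) * t - (L - 1) * (θ / L)) - Real.sin θ / (L * Real.sin (θ / L))

/-- The function of `θ` whose zeros make the boundary terms cancel when the matrix `ρ ^ |i - j|`
acts on the mode `m` of frequency `2 θ / L`. -/
noncomputable def quantizationDefect (ρ : ℝ) (L m : ℕ) (θ : ℝ) : ℝ :=
  if Odd m then
    Real.sin θ * Real.cos (θ / L) * (1 - ρ) + Real.cos θ * Real.sin (θ / L) * (1 + ρ)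
  else
    (1 - ρ) * L * Real.sin (θ / L) *
        (Real.cos θ * Real.cos (θ / L) * (1 - ρ) - Real.sin θ * Real.sin (θ / L) * (1 + ρ)) -
      Real.sin θ * ((1 - ρ) ^ 2 + 4 * ρ * Real.sin (θ / L) ^ 2)

theorem continuous_quantizationDefect (ρ : ℝ) (L m : ℕ) :
    Continuous (quantizationDefect ρ L m) := by
  unfold quantizationDefect
  split_ifs <;> fun_prop

theorem toeplitzSymbol_pos {ρ δ : ℝ} (h0 : 0 < ρ) (h1 : ρ < 1) : 0 < toeplitzSymbol ρ δ := by
  have : 0 < (1 - ρ) ^ 2 := pow_pos (by linarith) 2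
  exact div_pos (by nlinarith) (by positivity)

theorem toeplitzSymbol_strictAntiOn {ρ : ℝ} (h0 : 0 < ρ) (h1 : ρ < 1) :
    StrictAntiOn (toeplitzSymbol ρ) (Set.Icc 0 (Real.pi / 2)) := by
  intro a ha b hb hab
  have hs : Real.sin a < Real.sin b :=
    Real.strictMonoOn_sin ⟨by linarith [ha.1, Real.pi_pos], ha.2⟩
      ⟨by linarith [hb.1, Real.pi_pos], hb.2⟩ hab
  have hs0 : 0 ≤ Real.sin a :=
    Real.sin_nonneg_of_nonneg_of_le_pi ha.1 (by linarith [ha.2, Real.pi_pos])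
  have : 0 < (1 - ρ) ^ 2 := pow_pos (by linarith) 2
  refine div_lt_div_of_pos_left (by nlinarith) (by positivity) ?_
  have := pow_lt_pow_left₀ hs hs0 two_ne_zero
  nlinarith

/-- Convolution of a solution of the recurrence `f (t + 1) + f (t - 1) = 2 c f t` with the
exponential kernel: up to the factor `1 - 2 ρ c + ρ ^ 2`, a multiple of `f` and one boundary term
for each end of the lattice `{0, …, i + T}`. In truncated subtraction, `i - j + (j - i)` is the
distance `|i - j|`. -/
theorem sum_pow_mul_of_recurrence {f : ℝ → ℝ} {c : ℝ}
    (hf : ∀ t, f (t + 1) + f (t - 1) = 2 * c * f t) (ρ : ℝ) (i T : ℕ) :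
    (1 - 2 * ρ * c + ρ ^ 2) * ∑ j ∈ Finset.range (i + 1 + T), ρ ^ (i - j + (j - i)) * f j =
      (1 - ρ ^ 2) * f i - ρ ^ (T + 1) * (f (i + 1 + T : ℕ) - ρ * f (i + T : ℕ)) -
        ρ ^ (i + 1) * (f (-1) - ρ * f 0) := by
  have hleft : ∀ i : ℕ, (1 - 2 * ρ * c + ρ ^ 2) * ∑ j ∈ Finset.range (i + 1), ρ ^ (i - j) * f j =
      f i - ρ * f (i + 1) - ρ ^ (i + 1) * (f (-1) - ρ * f 0) := by
    intro i
    induction i with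
    | zero =>
      have := hf 0
      simp only [zero_add, zero_sub] at this
      simp
      linear_combination ρ * this
    | succ i ih =>
      have h1 : ∑ j ∈ Finset.range (i + 1), ρ ^ (i + 1 - j) * f j
          = ρ * ∑ j ∈ Finset.range (i + 1), ρ ^ (i - j) * f j := by
        rw [Finset.mul_sum]
        refine Finset.sum_congr rfl fun j hj => ?_
        rw [Nat.sub_add_comm (Nat.lt_succ_iff.1 (Finset.mem_range.1 hj)), pow_succ]
        ring
      have h2 := hf (i + 1)
      rw [add_sub_cancel_right] at h2
      rw [Finset.sum_range_succ, h1, Nat.sub_self, pow_zero, one_mul]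
      push_cast
      linear_combination ρ * ih + ρ * h2
  induction T with
  | zero =>
    have h1 : ∑ j ∈ Finset.range (i + 1 + 0), ρ ^ (i - j + (j - i)) * f j
        = ∑ j ∈ Finset.range (i + 1), ρ ^ (i - j) * f j := by
      refine Finset.sum_congr rfl fun j hj => ?_
      rw [Nat.sub_eq_zero_of_le (Nat.lt_succ_iff.1 (Finset.mem_range.1 hj)), add_zero]
    rw [h1, hleft]
    push_cast
    simp only [add_zero]
    ring
  | succ T ih =>
    have h2 := hf (i + 1 + T : ℕ)
    have h3 : i - (i + 1 + T) + (i + 1 + T - i) = T + 1 := by omega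
    rw [← add_assoc, Finset.sum_range_succ, h3, mul_add, ih]
    push_cast at h2 ⊢
    rw [show (i : ℝ) + (T + 1) = i + 1 + T by ring, show (i : ℝ) + 1 + T - 1 = i + T by ring,
      show (i : ℝ) + 1 + T + 1 = i + 1 + (T + 1) by ring] at *
    linear_combination ρ ^ (T + 2) * h2

theorem sum_cos_mul_sin (δ φ : ℝ) (n : ℕ) :
    (∑ j ∈ Finset.range n, Real.cos (2 * δ * j + φ)) * (2 * Real.sin δ) =
      Real.sin (2 * δ * n + φ - δ) - Real.sin (φ - δ) := by
  induction n with
  | zero => simp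
  | succ n ih =>
    have h1 : Real.sin (2 * δ * (n + 1 : ℕ) + φ - δ) = Real.sin ((2 * δ * n + φ) + δ) := by
      push_cast; ring_nf
    rw [Finset.sum_range_succ, add_mul, ih, h1, Real.sin_add, Real.sin_sub (2 * δ * n + φ)]
    ring

theorem sum_sin_mul_sin (δ φ : ℝ) (n : ℕ) :
    (∑ j ∈ Finset.range n, Real.sin (2 * δ * j + φ)) * (2 * Real.sin δ) =
      Real.cos (φ - δ) - Real.cos (2 * δ * n + φ - δ) := by
  induction n with
  | zero => simp
  | succ n ih =>
    have h1 : Real.cos (2 * δ * (n + 1 : ℕ) + φ - δ) = Real.cos ((2 * δ * n + φ) + δ) := by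
      push_cast; ring_nf
    rw [Finset.sum_range_succ, add_mul, ih, h1, Real.cos_add, Real.cos_sub (2 * δ * n + φ)]
    ring

theorem sum_cos_lattice {L : ℕ} (hL : L ≠ 0) {θ : ℝ} (hs : Real.sin (θ / L) ≠ 0) :
    ∑ j ∈ Finset.range L, Real.cos (2 * (θ / L) * j - (L - 1) * (θ / L)) =
      Real.sin θ / Real.sin (θ / L) := by
  have hL' : (L : ℝ) ≠ 0 := by exact_mod_cast hL
  have h := sum_cos_mul_sin (θ / L) (-((L - 1) * (θ / L))) L
  rw [show 2 * (θ / L) * L + -((L - 1) * (θ / L)) - θ / L = θ by field_simp; ring,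
    show -((L - 1) * (θ / L)) - θ / L = -θ by field_simp; ring, Real.sin_neg] at h
  simp only [← sub_eq_add_neg] at h
  rw [eq_div_iff hs]
  linarith

theorem sum_latticeMode {L : ℕ} (hL : L ≠ 0) (m : ℕ) {θ : ℝ} (hs : Real.sin (θ / L) ≠ 0) :
    ∑ j ∈ Finset.range L, latticeMode L m θ j = 0 := by
  have hL' : (L : ℝ) ≠ 0 := by exact_mod_cast hL
  unfold latticeMode
  split_ifs
  · have h := sum_sin_mul_sin (θ / L) (-((L - 1) * (θ / L))) L
    rw [show 2 * (θ / L) * L + -((L - 1) * (θ / L)) - θ / L = θ by field_simp; ring,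
      show -((L - 1) * (θ / L)) - θ / L = -θ by field_simp; ring, Real.cos_neg, sub_self] at h
    simp only [← sub_eq_add_neg] at h
    exact (mul_eq_zero.1 h).resolve_right (mul_ne_zero two_ne_zero hs)
  · rw [Finset.sum_sub_distrib, sum_cos_lattice hL hs]
    simp
    field_simp
    ring

theorem sum_latticeMode_sq {L : ℕ} (hL : L ≠ 0) (m : ℕ) {θ : ℝ} (hs : Real.sin (θ / L) ≠ 0)
    (hs2 : Real.sin (2 * θ / L) ≠ 0) :
    (∑ j ∈ Finset.range L, latticeMode L m θ j ^ 2) / L =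
      if Odd m then 1 / 2 - Real.sin (2 * θ) / (2 * (L * Real.sin (2 * θ / L)))
      else 1 / 2 + Real.sin (2 * θ) / (2 * (L * Real.sin (2 * θ / L))) -
        (Real.sin θ / (L * Real.sin (θ / L))) ^ 2 := by
  have hL' : (L : ℝ) ≠ 0 := by exact_mod_cast hL
  have h2 := sum_cos_lattice hL hs2
  have harg : ∀ j : ℕ, 2 * (2 * θ / L) * j - (L - 1) * (2 * θ / L)
      = 2 * (2 * (θ / L) * j - (L - 1) * (θ / L)) := fun j => by ring
  simp only [harg] at h2
  unfold latticeMode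
  split_ifs
  · simp only [Real.sin_sq_eq_half_sub, Finset.sum_sub_distrib, ← Finset.sum_div, h2]
    simp
    field_simp
  · have h1 := sum_cos_lattice hL hs
    simp only [sub_sq, Finset.sum_sub_distrib, Finset.sum_add_distrib, Real.cos_sq,
      ← Finset.sum_div, h2, ← Finset.sum_mul, ← Finset.mul_sum, h1]
    simp
    field_simp
    ring

/-- At a zero of the quantization defect, the lattice mode is an eigenvector of the exponential
kernel up to a constant. -/
theorem exists_sum_latticeMode_eq {ρ : ℝ} (h0 : 0 < ρ) (h1 : ρ < 1) {L : ℕ} (m : ℕ) {θ : ℝ}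
    (hs : Real.sin (θ / L) ≠ 0) (hF : quantizationDefect ρ L m θ = 0) :
    ∃ c : ℝ, ∀ i < L, ∑ j ∈ Finset.range L, ρ ^ (i - j + (j - i)) * latticeMode L m θ j =
      toeplitzSymbol ρ (θ / L) * latticeMode L m θ i + c := by
  rcases Nat.eq_zero_or_pos L with rfl | hL
  · simp
  have hL' : (L : ℝ) ≠ 0 := by exact_mod_cast hL.ne'
  have hρ : 0 < (1 - ρ) ^ 2 := pow_pos (by linarith) 2
  have hD : 0 < (1 - ρ) ^ 2 + 4 * ρ * Real.sin (θ / L) ^ 2 := by positivity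
  have hDc : 1 - 2 * ρ * Real.cos (2 * (θ / L)) + ρ ^ 2
      = (1 - ρ) ^ 2 + 4 * ρ * Real.sin (θ / L) ^ 2 := by
    rw [Real.cos_two_mul, Real.cos_sq']; ring
  have e1 : ∀ i T : ℕ, i + 1 + T = L →
      2 * (θ / L) * (i + 1 + T : ℕ) - (L - 1) * (θ / L) = θ + θ / L := by
    intro i T h; rw [h]; field_simp; ring
  have e2 : ∀ i T : ℕ, i + 1 + T = L →
      2 * (θ / L) * (i + T : ℕ) - (L - 1) * (θ / L) = θ - θ / L := by
    intro i T h
    have : ((i + T : ℕ) : ℝ) = L - 1 := by rw [← h]; push_cast; ring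
    rw [this]; field_simp; ring
  have e3 : 2 * (θ / L) * (-1) - (L - 1) * (θ / L) = -(θ + θ / L) := by field_simp; ring
  have e4 : 2 * (θ / L) * 0 - (L - 1) * (θ / L) = -(θ - θ / L) := by field_simp; ring
  unfold quantizationDefect at hF
  unfold latticeMode toeplitzSymbol
  split_ifs at hF ⊢ with hm
  · refine ⟨0, fun i hi => ?_⟩
    obtain ⟨T, hT⟩ := Nat.exists_eq_add_of_lt hi
    have hT' : i + 1 + T = L := by omega
    have key := sum_pow_mul_of_recurrence
      (f := fun t => Real.sin (2 * (θ / L) * t - (L - 1) * (θ / L)))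
      (c := Real.cos (2 * (θ / L))) (fun t => by
        rw [show 2 * (θ / L) * (t + 1) - (L - 1) * (θ / L)
            = (2 * (θ / L) * t - (L - 1) * (θ / L)) + 2 * (θ / L) by ring,
          show 2 * (θ / L) * (t - 1) - (L - 1) * (θ / L)
            = (2 * (θ / L) * t - (L - 1) * (θ / L)) - 2 * (θ / L) by ring,
          Real.sin_add (2 * (θ / L) * t - (L - 1) * (θ / L)),
          Real.sin_sub (2 * (θ / L) * t - (L - 1) * (θ / L))]
        ring) ρ i T
    simp only [e1 i T hT', e2 i T hT', e3, e4, hDc, Real.sin_neg, Real.sin_add θ,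
      Real.sin_sub θ] at key
    rw [hT'] at key
    rw [add_zero, div_mul_eq_mul_div, eq_div_iff hD.ne', mul_comm]
    linear_combination key + (ρ ^ (i + 1) - ρ ^ (T + 1)) * hF
  · refine ⟨(1 - ρ ^ 2) / ((1 - ρ) ^ 2 + 4 * ρ * Real.sin (θ / L) ^ 2) *
      (Real.sin θ / (L * Real.sin (θ / L))) -
        (Real.sin θ / (L * Real.sin (θ / L))) * ((1 + ρ) / (1 - ρ)), fun i hi => ?_⟩
    obtain ⟨T, hT⟩ := Nat.exists_eq_add_of_lt hi
    have hT' : i + 1 + T = L := by omega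
    have key := sum_pow_mul_of_recurrence
      (f := fun t => Real.cos (2 * (θ / L) * t - (L - 1) * (θ / L)))
      (c := Real.cos (2 * (θ / L))) (fun t => by
        rw [show 2 * (θ / L) * (t + 1) - (L - 1) * (θ / L)
            = (2 * (θ / L) * t - (L - 1) * (θ / L)) + 2 * (θ / L) by ring,
          show 2 * (θ / L) * (t - 1) - (L - 1) * (θ / L)
            = (2 * (θ / L) * t - (L - 1) * (θ / L)) - 2 * (θ / L) by ring,
          Real.cos_add (2 * (θ / L) * t - (L - 1) * (θ / L)),
          Real.cos_sub (2 * (θ / L) * t - (L - 1) * (θ / L))]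
        ring) ρ i T
    have key1 := sum_pow_mul_of_recurrence (f := fun _ => 1) (c := 1) (fun t => by ring) ρ i T
    simp only [e1 i T hT', e2 i T hT', e3, e4, hDc, Real.cos_neg, Real.cos_add θ,
      Real.cos_sub θ] at key
    rw [hT'] at key key1
    simp only [mul_one] at key1
    set D := (1 - ρ) ^ 2 + 4 * ρ * Real.sin (θ / L) ^ 2 with hDdef
    simp only [mul_sub, Finset.sum_sub_distrib, ← Finset.sum_mul]
    have h1ρ : 1 - ρ ≠ 0 := by linarith
    have hS1 : ∑ j ∈ Finset.range L, ρ ^ (i - j + (j - i)) =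
        ((1 - ρ ^ 2) - (ρ ^ (T + 1) + ρ ^ (i + 1)) * (1 - ρ)) / (1 - ρ) ^ 2 := by
      rw [eq_div_iff (pow_ne_zero 2 h1ρ)]
      linear_combination key1
    have hS2 : ∑ j ∈ Finset.range L, ρ ^ (i - j + (j - i)) *
        Real.cos (2 * (θ / L) * j - (L - 1) * (θ / L)) =
        ((1 - ρ ^ 2) * Real.cos (2 * (θ / L) * i - (L - 1) * (θ / L)) -
          (ρ ^ (T + 1) + ρ ^ (i + 1)) * (Real.cos θ * Real.cos (θ / L) * (1 - ρ) -
            Real.sin θ * Real.sin (θ / L) * (1 + ρ))) / D := by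
      rw [eq_div_iff hD.ne']
      linear_combination key
    -- vanishing of the defect: the boundary terms of the cosine and of its mean cancel
    have hβ : (Real.cos θ * Real.cos (θ / L) * (1 - ρ) -
        Real.sin θ * Real.sin (θ / L) * (1 + ρ)) / D =
        Real.sin θ / (L * Real.sin (θ / L)) / (1 - ρ) := by
      rw [div_div, div_eq_div_iff hD.ne' (by positivity)]
      linear_combination hF
    have hc : (1 - ρ ^ 2) / (1 - ρ) ^ 2 = (1 + ρ) / (1 - ρ) := by field_simp; ring
    rw [hS1, hS2, sub_div, sub_div, mul_div_assoc, mul_div_assoc, hβ, hc]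
    field_simp
    ring

theorem exists_latticeMode_ne_zero {L m : ℕ} (hL : 3 ≤ L) {θ : ℝ} (hθ0 : 0 < θ / L)
    (hθ1 : θ / L < Real.pi / 2) : ∃ j < L, latticeMode L m θ j ≠ 0 := by
  -- three consecutive values determine the phase and the mean, so they cannot all vanish
  by_contra! h
  have h0 := h 0 (by omega)
  have h1 := h 1 (by omega)
  have h2 := h 2 (by omega)
  have hsin : Real.sin (2 * (θ / L)) ≠ 0 := (Real.sin_pos_of_pos_of_lt_pi (by linarith)
    (by linarith)).ne'
  have hp := Real.sin_sq_add_cos_sq ((L - 1) * (θ / L))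
  have hq := Real.sin_sq_add_cos_sq (2 * (θ / L))
  unfold latticeMode at h0 h1 h2
  split_ifs at h0 h1 h2
  · simp only [Nat.cast_zero, Nat.cast_one, mul_zero, mul_one, zero_sub, Real.sin_neg,
      neg_eq_zero] at h0 h1
    rw [Real.sin_sub, h0, mul_zero, sub_zero] at h1
    have := (mul_eq_zero.1 h1).resolve_left hsin
    rw [h0, this] at hp
    norm_num at hp
  · have e2 : 2 * (θ / L) * (2 : ℕ) = 2 * (2 * (θ / L)) := by push_cast; ring
    rw [e2] at h2
    simp only [Nat.cast_zero, Nat.cast_one, mul_zero, mul_one, zero_sub, Real.cos_neg,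
      Real.cos_sub, Real.cos_two_mul (2 * (θ / L)), Real.sin_two_mul (2 * (θ / L))] at h0 h1 h2
    have hc : Real.cos (2 * (θ / L)) - 1 ≠ 0 := by
      intro h
      have : Real.cos (2 * (θ / L)) = 1 := by linarith
      rw [this] at hq
      apply hsin
      nlinarith
    set M := Real.sin θ / (L * Real.sin (θ / L))
    have hM : M = 0 := by
      have : M * (2 * (Real.cos (2 * (θ / L)) - 1)) = 0 := by
        linear_combination h0 + h2 - 2 * Real.cos (2 * (θ / L)) * h1
      exact (mul_eq_zero.1 this).resolve_right (mul_ne_zero two_ne_zero hc)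
    have hX : Real.cos ((L - 1) * (θ / L)) = 0 := by linarith
    rw [hX, hM, mul_zero, zero_add, sub_zero] at h1
    have := (mul_eq_zero.1 h1).resolve_left hsin
    rw [hX, this] at hp
    norm_num at hp

/-- The quantization defect of the mode `m` vanishes between `m π / 2` and `(m + 1) π / 2`. -/
theorem exists_quantizationDefect_eq_zero {ρ : ℝ} (h0 : 0 < ρ) (h1 : ρ < 1) {L m : ℕ}
    (hm : 1 ≤ m) (hmL : m < L) :
    ∃ θ ∈ Set.Ioo (m * (Real.pi / 2)) ((m + 1) * (Real.pi / 2)),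
      quantizationDefect ρ L m θ = 0 := by
  have hπ := Real.pi_pos
  have hL : (0 : ℝ) < L := by exact_mod_cast (by omega : 0 < L)
  have hm' : (1 : ℝ) ≤ m := by exact_mod_cast hm
  have hmL' : (m : ℝ) + 1 ≤ L := by exact_mod_cast hmL
  have hρ : 0 < 1 - ρ := by linarith
  apply exists_Ioo_eq_zero (continuous_quantizationDefect ρ L m) (by nlinarith)
  set a := m * (Real.pi / 2) with ha
  set b := (m + 1) * (Real.pi / 2) with hb
  have ha0 : 0 < a / L := by positivity
  have ha1 : a / L < Real.pi / 2 := by rw [div_lt_iff₀ hL]; nlinarith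
  have hb0 : 0 < b / L := by positivity
  have hb1 : b / L ≤ Real.pi / 2 := by rw [div_le_iff₀ hL]; nlinarith
  have hsa := Real.sin_pos_of_pos_of_lt_pi ha0 (by linarith)
  have hca := Real.cos_pos_of_mem_Ioo ⟨by linarith, ha1⟩
  have hsb := Real.sin_pos_of_pos_of_lt_pi hb0 (by linarith)
  rcases Nat.even_or_odd' m with ⟨n, rfl | rfl⟩
  · have hpar : ¬ Odd (2 * n) := Nat.not_odd_iff_even.2 (even_two_mul n)
    have ea : a = n * Real.pi := by rw [ha]; push_cast; ring
    have eb : b = n * Real.pi + Real.pi / 2 := by rw [hb]; push_cast; ring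
    have s1 : Real.sin a = 0 := by rw [ea, Real.sin_nat_mul_pi]
    have c1 : Real.cos a = (-1) ^ n := by rw [ea, Real.cos_nat_mul_pi]
    have s2 : Real.sin b = (-1) ^ n := by rw [eb, Real.sin_add_pi_div_two, Real.cos_nat_mul_pi]
    have c2 : Real.cos b = 0 := by
      rw [eb, Real.cos_add_pi_div_two, Real.sin_nat_mul_pi, neg_zero]
    have hsq : ((-1 : ℝ) ^ n) ^ 2 = 1 := by rw [← pow_mul, mul_comm, pow_mul]; norm_num
    simp only [quantizationDefect, hpar, if_false, s1, c1, s2, c2]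
    have : 0 < ((1 - ρ) * L * Real.sin (a / L) * (Real.cos (a / L) * (1 - ρ))) *
        ((1 - ρ) * L * Real.sin (b / L) * (Real.sin (b / L) * (1 + ρ)) +
          ((1 - ρ) ^ 2 + 4 * ρ * Real.sin (b / L) ^ 2)) := by positivity
    linear_combination this - (((1 - ρ) * L * Real.sin (a / L) * (Real.cos (a / L) * (1 - ρ))) *
        ((1 - ρ) * L * Real.sin (b / L) * (Real.sin (b / L) * (1 + ρ)) +
          ((1 - ρ) ^ 2 + 4 * ρ * Real.sin (b / L) ^ 2))) * hsq
  · have hpar : Odd (2 * n + 1) := odd_two_mul_add_one n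
    have ea : a = n * Real.pi + Real.pi / 2 := by rw [ha]; push_cast; ring
    have eb : b = n * Real.pi + Real.pi := by rw [hb]; push_cast; ring
    have s1 : Real.sin a = (-1) ^ n := by rw [ea, Real.sin_add_pi_div_two, Real.cos_nat_mul_pi]
    have c1 : Real.cos a = 0 := by
      rw [ea, Real.cos_add_pi_div_two, Real.sin_nat_mul_pi, neg_zero]
    have s2 : Real.sin b = 0 := by rw [eb, Real.sin_add_pi, Real.sin_nat_mul_pi, neg_zero]
    have c2 : Real.cos b = -(-1) ^ n := by rw [eb, Real.cos_add_pi, Real.cos_nat_mul_pi]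
    have hsq : ((-1 : ℝ) ^ n) ^ 2 = 1 := by rw [← pow_mul, mul_comm, pow_mul]; norm_num
    simp only [quantizationDefect, hpar, if_true, s1, c1, s2, c2]
    have : 0 < (Real.cos (a / L) * (1 - ρ)) * (Real.sin (b / L) * (1 + ρ)) := by positivity
    linear_combination this -
      ((Real.cos (a / L) * (1 - ρ)) * (Real.sin (b / L) * (1 + ρ))) * hsq

/-- The columns of the PCA projection of an embedding whose centered Gram matrix is the doubly
centered exponential kernel on `L` lattice sites are, up to signs, the normalized lattice modes
scaled by the square roots of the eigenvalues. -/
theorem IsPCAProjection.exists_column_eq_latticeMode {ι : Type*} [Fintype ι] [DecidableEq ι]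
    {d L : ℕ} (hL : 3 ≤ L) (e : ι ≃ Fin L) {ρ : ℝ} (h0 : 0 < ρ) (h1 : ρ < 1)
    {K : Matrix ι ι ℝ} (hK : ∀ i j, K i j = ρ ^ ((e i : ℕ) - e j + (e j - e i)))
    {A : Matrix ι (Fin d) ℝ} {B : Matrix ι (Fin (min (Fintype.card ι) d)) ℝ}
    (hA : A * Aᵀ = centeringMatrix ι * K * centeringMatrix ι) (hB : IsPCAProjection A B)
    {m : ℕ} (hm : 1 ≤ m) (hmL : m < L) {θ : ℝ}
    (hθ : θ ∈ Set.Ioo (m * (Real.pi / 2)) ((m + 1) * (Real.pi / 2)))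
    (hF : quantizationDefect ρ L m θ = 0) :
    ∃ (h : m - 1 < min (Fintype.card ι) d) (s : ℝ), (s = 1 ∨ s = -1) ∧
      (∀ i, B i ⟨m - 1, h⟩ = s * (√(toeplitzSymbol ρ (θ / L)) * (latticeMode L m θ (e i : ℕ) /
        √(∑ j ∈ Finset.range L, latticeMode L m θ j ^ 2)))) ∧
      ∑ i, B i ⟨m - 1, h⟩ ^ 2 = toeplitzSymbol ρ (θ / L) := by
  obtain ⟨r, rfl⟩ : ∃ r, L = r + 1 := ⟨L - 1, by omega⟩
  have hπ := Real.pi_pos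
  have hι : Fintype.card ι = r + 1 := by simpa using Fintype.card_congr e
  -- one zero of the quantization defect for every mode, the given one for the mode `m`
  obtain ⟨Θ, hΘm, hΘ⟩ : ∃ Θ : ℕ → ℝ, Θ m = θ ∧ ∀ n, 1 ≤ n → n < r + 1 →
      Θ n ∈ Set.Ioo (n * (Real.pi / 2)) ((n + 1) * (Real.pi / 2)) ∧
        quantizationDefect ρ (r + 1) n (Θ n) = 0 := by
    have hex : ∀ n : ℕ, ∃ x : ℝ, (n = m → x = θ) ∧ (1 ≤ n → n < r + 1 →
        x ∈ Set.Ioo (n * (Real.pi / 2)) ((n + 1) * (Real.pi / 2)) ∧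
          quantizationDefect ρ (r + 1) n x = 0) := by
      intro n
      by_cases hnm : n = m
      · subst hnm
        exact ⟨θ, fun _ => rfl, fun _ _ => ⟨hθ, hF⟩⟩
      · by_cases hn : 1 ≤ n ∧ n < r + 1
        · obtain ⟨x, hx, hx'⟩ := exists_quantizationDefect_eq_zero h0 h1 hn.1 hn.2
          exact ⟨x, fun h => absurd h hnm, fun _ _ => ⟨hx, hx'⟩⟩
        · exact ⟨0, fun h => absurd h hnm, fun h h' => absurd ⟨h, h'⟩ hn⟩
    choose Θ hΘ using hex
    exact ⟨Θ, (hΘ m).1 rfl, fun n => (hΘ n).2⟩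
  have hr : (0 : ℝ) < (r + 1 : ℕ) := by positivity
  have hpos : ∀ n, 1 ≤ n → n < r + 1 → 0 < Θ n / (r + 1 : ℕ) := fun n hn hnr =>
    div_pos (lt_of_le_of_lt (by positivity) (hΘ n hn hnr).1.1) hr
  have hlt : ∀ n, 1 ≤ n → n < r + 1 → Θ n / (r + 1 : ℕ) < Real.pi / 2 := fun n hn hnr => by
    have h2 : (n : ℝ) + 1 ≤ (r + 1 : ℕ) := by exact_mod_cast hnr
    have := (hΘ n hn hnr).1.2
    rw [div_lt_iff₀ hr]
    nlinarith
  have hsin : ∀ n, 1 ≤ n → n < r + 1 → Real.sin (Θ n / (r + 1 : ℕ)) ≠ 0 := fun n hn hnr =>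
    (Real.sin_pos_of_pos_of_lt_pi (hpos n hn hnr) (by linarith [hlt n hn hnr])).ne'
  have hmono : ∀ n n', 1 ≤ n → n < n' → n' < r + 1 →
      toeplitzSymbol ρ (Θ n' / (r + 1 : ℕ)) < toeplitzSymbol ρ (Θ n / (r + 1 : ℕ)) := by
    intro n n' hn hnn hnr
    refine toeplitzSymbol_strictAntiOn h0 h1
      ⟨(hpos n hn (by omega)).le, (hlt n hn (by omega)).le⟩
      ⟨(hpos n' (by omega) hnr).le, (hlt n' (by omega) hnr).le⟩ ?_
    have h2 : (n : ℝ) + 1 ≤ n' := by exact_mod_cast hnn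
    have h3 := (hΘ n hn (by omega)).1.2
    have h4 := (hΘ n' (by omega) hnr).1.1
    exact div_lt_div_of_pos_right (by nlinarith) hr
  have hsum : ∀ f : ℕ → ℝ, ∑ i, f (e i : ℕ) = ∑ j ∈ Finset.range (r + 1), f j := fun f => by
    rw [← Fin.sum_univ_eq_sum_range, ← Equiv.sum_comp e]
  -- the last index carries the constant vector, the kernel of the centering matrix
  let v : Fin (r + 1) → ι → ℝ := fun n i =>
    if (n : ℕ) < r then latticeMode (r + 1) (n + 1) (Θ (n + 1)) (e i : ℕ) else 1
  let l : Fin (r + 1) → ℝ := fun n =>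
    if (n : ℕ) < r then toeplitzSymbol ρ (Θ (n + 1) / (r + 1 : ℕ)) else 0
  have hlast : ∀ n : Fin (r + 1), n ≠ Fin.last r → (n : ℕ) < r := fun n hn => by
    have : (n : ℕ) ≠ r := fun h => hn (Fin.ext h)
    omega
  have hl : StrictAnti l := by
    intro a b hab
    rw [Fin.lt_def] at hab
    simp only [l]
    rw [if_pos (show (a : ℕ) < r by omega)]
    split_ifs with hb
    · exact hmono _ _ (by omega) (by omega) (by omega)
    · exact toeplitzSymbol_pos h0 h1
  have hl0 : ∀ n : Fin (r + 1), n ≠ Fin.last r → l n ≠ 0 := fun n hn => by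
    simp only [l, if_pos (hlast n hn)]
    exact (toeplitzSymbol_pos h0 h1).ne'
  have hv : ∀ n, v n ≠ 0 := by
    intro n hn
    by_cases hnr : (n : ℕ) < r
    · obtain ⟨j, hj, hj'⟩ := exists_latticeMode_ne_zero (m := n + 1) hL
        (hpos (n + 1) (by omega) (by omega)) (hlt (n + 1) (by omega) (by omega))
      have := congrFun hn (e.symm ⟨j, hj⟩)
      simp only [v, if_pos hnr, Equiv.apply_symm_apply] at this
      exact hj' this
    · have := congrFun hn (e.symm ⟨0, by omega⟩)
      simp only [v, if_neg hnr, Pi.zero_apply, one_ne_zero] at this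
  have hG : ∀ n, (A * Aᵀ) *ᵥ v n = l n • v n := by
    intro n
    rw [hA]
    by_cases hnr : (n : ℕ) < r
    · obtain ⟨c, hc⟩ := exists_sum_latticeMode_eq h0 h1 (n + 1)
        (hsin (n + 1) (by omega) (by omega)) (hΘ (n + 1) (by omega) (by omega)).2
      simp only [v, l, if_pos hnr]
      refine centeringMatrix_mul_mul_mulVec (c := c) ?_ fun i => ?_
      · rw [hsum fun j => latticeMode (r + 1) (n + 1) (Θ (n + 1)) j]
        exact sum_latticeMode (by omega) _ (hsin (n + 1) (by omega) (by omega))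
      · simp only [hK]
        rw [hsum fun j => ρ ^ ((e i : ℕ) - j + (j - e i)) *
          latticeMode (r + 1) (n + 1) (Θ (n + 1)) j]
        exact hc _ (e i).2
    · have hconst : centeringMatrix ι *ᵥ v n = 0 := by
        ext i
        rw [centeringMatrix_mulVec]
        simp only [v, if_neg hnr]
        simp [hι]
        field_simp
        ring
      rw [← mulVec_mulVec, hconst, mulVec_zero]
      simp [l, if_neg hnr]
  have hmr : m - 1 < r := by omega
  obtain ⟨h, s, hs, hcol, hnorm⟩ := hB.exists_column_eq hι hl hl0 hv hG ⟨m - 1, by omega⟩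
    (fun h => by simp [Fin.ext_iff] at h; omega)
  simp only [v, l, if_pos hmr, Nat.sub_add_cancel hm, hΘm] at hcol hnorm
  rw [hsum fun j => latticeMode (r + 1) m θ j ^ 2] at hcol
  exact ⟨h, s, hs, hcol, hnorm⟩

/-! ### The quantization condition and the continuum modes -/

/-- The strictly increasing phase that equals an integer multiple of `π` exactly at the
solution of the quantization condition of the mode `μ`. -/
noncomputable def quantizationPhase (σ : ℝ) (μ : ℕ) (k : ℝ) : ℝ :=
  if Odd μ then k + Real.arctan (σ * k)
  else k - Real.arctan (k / (1 + σ * (1 + σ) * k ^ 2))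

/-- The value of the phase at the solution of the quantization condition, in units of `π`. -/
def phaseIndex (μ : ℕ) : ℕ := if Odd μ then (μ + 1) / 2 else μ / 2

theorem phaseIndex_mul_pi (μ : ℕ) :
    phaseIndex μ * Real.pi = if Odd μ then ((μ : ℝ) + 1) * Real.pi / 2 else μ * Real.pi / 2 := by
  unfold phaseIndex
  split_ifs with h
  · obtain ⟨n, rfl⟩ := h
    rw [show (2 * n + 1 + 1) / 2 = n + 1 by omega]
    push_cast
    ring
  · obtain ⟨n, rfl⟩ := Nat.not_odd_iff_even.1 h
    rw [show (n + n) / 2 = n by omega]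
    push_cast
    ring

theorem eq_quantizationRHS_iff (σ : ℝ) (μ : ℕ) (k : ℝ) :
    k = quantizationRHS σ μ k ↔ quantizationPhase σ μ k = phaseIndex μ * Real.pi := by
  rw [phaseIndex_mul_pi]
  unfold quantizationRHS quantizationPhase
  split_ifs <;> constructor <;> intro h <;> linarith

theorem arctan_sub_arctan_le {x y : ℝ} (h : x ≤ y) : Real.arctan y - Real.arctan x ≤ y - x := by
  have hd : ∀ z : ℝ, HasDerivAt (fun z => z - Real.arctan z) (1 - 1 / (1 + z ^ 2)) z := fun z =>
    (hasDerivAt_id z).sub (Real.hasDerivAt_arctan z)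
  have hm : Monotone fun z => z - Real.arctan z := by
    refine monotone_of_deriv_nonneg (fun z => (hd z).differentiableAt) fun z => ?_
    rw [(hd z).deriv, sub_nonneg, div_le_one (by positivity)]
    nlinarith [sq_nonneg z]
  have := hm h
  simp only at this
  linarith

theorem continuous_quantizationPhase {σ : ℝ} (hσ : 0 < σ) (μ : ℕ) :
    Continuous (quantizationPhase σ μ) := by
  unfold quantizationPhase
  split_ifs
  · fun_prop
  · refine continuous_id.sub (Real.continuous_arctan.comp ?_)
    exact continuous_id.div (by fun_prop) fun x => by positivity

/-- For even modes the `1`-Lipschitz bound on `arctan` suffices: the argument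
`k / (1 + σ (1 + σ) k ^ 2)` grows more slowly than `k`. -/
theorem quantizationPhase_strictMonoOn {σ : ℝ} (hσ : 0 < σ) (μ : ℕ) :
    StrictMonoOn (quantizationPhase σ μ) (Set.Ici 0) := by
  intro a ha b hb hab
  have ha : 0 ≤ a := ha
  have hb0 : 0 < b := lt_of_le_of_lt ha hab
  unfold quantizationPhase
  split_ifs
  · exact add_lt_add hab (Real.arctan_strictMono (mul_lt_mul_of_pos_left hab hσ))
  · set c := σ * (1 + σ) with hc
    have hc0 : 0 < c := by positivity
    have hA : 0 < 1 + c * a ^ 2 := by positivity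
    have hB : 0 < 1 + c * b ^ 2 := by positivity
    rcases le_total (a / (1 + c * a ^ 2)) (b / (1 + c * b ^ 2)) with h | h
    · have h1 := arctan_sub_arctan_le h
      have h2 : b / (1 + c * b ^ 2) - a / (1 + c * a ^ 2) < b - a := by
        rw [div_sub_div _ _ hB.ne' hA.ne', div_lt_iff₀ (mul_pos hB hA)]
        have h3 : 0 < (b - a) * (c * a ^ 2 + c * b ^ 2 + c ^ 2 * a ^ 2 * b ^ 2 + c * a * b) :=
          mul_pos (by linarith) (by positivity)
        linear_combination h3
      linarith
    · have := Real.arctan_strictMono.monotone h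
      linarith

theorem quantizationPhase_mem_Ioo {σ : ℝ} (hσ : 0 < σ) {μ : ℕ} {k : ℝ}
    (hk : k ∈ Set.Icc (μ * (Real.pi / 2)) ((μ + 1) * (Real.pi / 2))) (hk0 : 0 < k) :
    quantizationPhase σ μ k ∈
      Set.Ioo (phaseIndex μ * Real.pi - Real.pi) (phaseIndex μ * Real.pi + Real.pi) := by
  have hπ := Real.pi_pos
  obtain ⟨h1, h2⟩ := hk
  rw [phaseIndex_mul_pi]
  unfold quantizationPhase
  split_ifs
  · have h3 := Real.arctan_pos.2 (mul_pos hσ hk0)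
    have h4 := Real.arctan_lt_pi_div_two (σ * k)
    constructor <;> nlinarith
  · have h3 := Real.arctan_pos.2
      (show 0 < k / (1 + σ * (1 + σ) * k ^ 2) by positivity)
    have h4 := Real.arctan_lt_pi_div_two (k / (1 + σ * (1 + σ) * k ^ 2))
    constructor <;> nlinarith

theorem mem_Ioo_of_eq_quantizationRHS {σ : ℝ} (hσ : 0 < σ) {μ : ℕ} {k : ℝ} (hk : 0 < k)
    (h : k = quantizationRHS σ μ k) :
    k ∈ Set.Ioo (μ * (Real.pi / 2)) ((μ + 1) * (Real.pi / 2)) := by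
  unfold quantizationRHS at h
  split_ifs at h
  · have h3 := Real.arctan_pos.2 (mul_pos hσ hk)
    have h4 := Real.arctan_lt_pi_div_two (σ * k)
    constructor <;> linarith
  · have h3 := Real.arctan_pos.2 (show 0 < k / (1 + σ * (1 + σ) * k ^ 2) by positivity)
    have h4 := Real.arctan_lt_pi_div_two (k / (1 + σ * (1 + σ) * k ^ 2))
    constructor <;> linarith

theorem existsUnique_eq_quantizationRHS {σ : ℝ} (hσ : 0 < σ) {μ : ℕ} (hμ : 1 ≤ μ) :
    ∃! k : ℝ, 0 < k ∧ k = quantizationRHS σ μ k := by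
  have hπ := Real.pi_pos
  have hμ' : (1 : ℝ) ≤ μ := by exact_mod_cast hμ
  have ha : 0 < μ * (Real.pi / 2) := by positivity
  have hab : μ * (Real.pi / 2) ≤ (μ + 1) * (Real.pi / 2) := by linarith
  have hends : quantizationPhase σ μ (μ * (Real.pi / 2)) ≤ phaseIndex μ * Real.pi ∧
      phaseIndex μ * Real.pi ≤ quantizationPhase σ μ ((μ + 1) * (Real.pi / 2)) := by
    rw [phaseIndex_mul_pi]
    unfold quantizationPhase
    split_ifs
    · have h3 := Real.arctan_lt_pi_div_two (σ * (μ * (Real.pi / 2)))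
      have h4 := Real.arctan_pos.2
        (show 0 < σ * ((μ + 1) * (Real.pi / 2)) by positivity)
      constructor <;> linarith
    · have h3 := Real.arctan_pos.2 (show 0 < (μ * (Real.pi / 2)) /
        (1 + σ * (1 + σ) * (μ * (Real.pi / 2)) ^ 2) by positivity)
      have h4 := Real.arctan_lt_pi_div_two (((μ + 1) * (Real.pi / 2)) /
        (1 + σ * (1 + σ) * ((μ + 1) * (Real.pi / 2)) ^ 2))
      constructor <;> linarith
  obtain ⟨k, hk, hk'⟩ := intermediate_value_Icc hab
    (continuous_quantizationPhase hσ μ).continuousOn hends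
  refine ⟨k, ⟨by linarith [hk.1], (eq_quantizationRHS_iff σ μ k).2 hk'⟩, fun k' h => ?_⟩
  refine (quantizationPhase_strictMonoOn hσ μ).injOn h.1.le
    (show (0 : ℝ) ≤ k by linarith [hk.1]) ?_
  rw [hk', ← eq_quantizationRHS_iff]
  exact h.2

/-- The scaling limit of the quantization defect of the lattice with `L` sites and kernel
`exp (-|x - y| / σ)`, as `L → ∞`, multiplied by `L` for odd modes and by `L ^ 2` for even modes. -/
noncomputable def limitDefect (σ : ℝ) (μ : ℕ) (θ : ℝ) : ℝ :=
  if Odd μ then 2 / σ * (Real.sin θ + σ * θ * Real.cos θ)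
  else 4 / σ ^ 2 * (θ * Real.cos θ - (1 + σ * (1 + σ) * θ ^ 2) * Real.sin θ)

/-- Up to a nonvanishing factor, of a sign depending only on `μ`, the limiting defect is the sine of
the phase. -/
theorem exists_limitDefect_eq_mul_sin {σ : ℝ} (hσ : 0 < σ) (μ : ℕ) (θ : ℝ) :
    ∃ C : ℝ, 0 < C ∧ limitDefect σ μ θ =
      (if Odd μ then C else -C) * Real.sin (quantizationPhase σ μ θ) := by
  have hsin : ∀ y, Real.sin (Real.arctan y) = y * Real.cos (Real.arctan y) := fun y => by
    rw [← Real.tan_mul_cos (Real.cos_arctan_pos y).ne', Real.tan_arctan]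
  unfold limitDefect quantizationPhase
  split_ifs
  · have hc := Real.cos_arctan_pos (σ * θ)
    refine ⟨2 / σ / Real.cos (Real.arctan (σ * θ)), by positivity, ?_⟩
    rw [Real.sin_add, hsin]
    field_simp
  · have hD : 0 < 1 + σ * (1 + σ) * θ ^ 2 := by positivity
    set D := 1 + σ * (1 + σ) * θ ^ 2
    have hc := Real.cos_arctan_pos (θ / D)
    refine ⟨4 / σ ^ 2 * D / Real.cos (Real.arctan (θ / D)), by positivity, ?_⟩
    rw [Real.sin_sub, hsin]
    field_simp
    ring

/-- The limiting defect changes sign at the solution of the quantization condition. -/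
theorem limitDefect_mul_neg {σ : ℝ} (hσ : 0 < σ) {μ : ℕ} {k a b : ℝ}
    (hk : k = quantizationRHS σ μ k) (ha : μ * (Real.pi / 2) ≤ a) (ha0 : 0 < a) (hak : a < k)
    (hkb : k < b) (hb : b ≤ (μ + 1) * (Real.pi / 2)) :
    limitDefect σ μ a * limitDefect σ μ b < 0 := by
  rw [eq_quantizationRHS_iff] at hk
  have h1 := quantizationPhase_mem_Ioo hσ ⟨ha, by linarith⟩ ha0
  have h2 := quantizationPhase_mem_Ioo hσ ⟨by linarith, hb⟩ (by linarith)
  have hka := quantizationPhase_strictMonoOn hσ μ ha0.le (by linarith : (0 : ℝ) ≤ k) hak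
  have hkb' := quantizationPhase_strictMonoOn hσ μ (by linarith : (0 : ℝ) ≤ k)
    (by linarith : (0 : ℝ) ≤ b) hkb
  rw [hk] at hka hkb'
  have sa := Real.sin_neg_of_neg_of_neg_pi_lt (sub_neg.2 hka) (by linarith [h1.1])
  have sb := Real.sin_pos_of_pos_of_lt_pi (sub_pos.2 hkb') (by linarith [h2.2])
  rw [Real.sin_sub_nat_mul_pi] at sa sb
  have hsq : ((-1 : ℝ) ^ phaseIndex μ) ^ 2 = 1 := by rw [← pow_mul, mul_comm, pow_mul]; norm_num
  have hss : Real.sin (quantizationPhase σ μ a) * Real.sin (quantizationPhase σ μ b) < 0 := by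
    have := mul_neg_of_neg_of_pos sa sb
    linear_combination this - Real.sin (quantizationPhase σ μ a) *
      Real.sin (quantizationPhase σ μ b) * hsq
  obtain ⟨C, hC, hCa⟩ := exists_limitDefect_eq_mul_sin hσ μ a
  obtain ⟨C', hC', hCb⟩ := exists_limitDefect_eq_mul_sin hσ μ b
  have := mul_neg_of_pos_of_neg (mul_pos hC hC') hss
  rw [hCa, hCb]
  split_ifs <;> linear_combination this

theorem tan_of_odd {σ : ℝ} {μ : ℕ} {k : ℝ} (hk : k = quantizationRHS σ μ k) (h : Odd μ) :
    Real.tan k = -σ * k := by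
  rw [eq_quantizationRHS_iff, quantizationPhase, if_pos h] at hk
  have : k = phaseIndex μ * Real.pi - Real.arctan (σ * k) := by linarith
  rw [this, Real.tan_nat_mul_pi_sub, Real.tan_arctan, ← this]
  ring

theorem tan_of_even {σ : ℝ} {μ : ℕ} {k : ℝ} (hk : k = quantizationRHS σ μ k) (h : Even μ) :
    Real.tan k = k / (1 + σ * (1 + σ) * k ^ 2) := by
  rw [eq_quantizationRHS_iff, quantizationPhase, if_neg (Nat.not_odd_iff_even.2 h)] at hk
  have : k = Real.arctan (k / (1 + σ * (1 + σ) * k ^ 2)) + phaseIndex μ * Real.pi := by linarith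
  calc Real.tan k
      = Real.tan (Real.arctan (k / (1 + σ * (1 + σ) * k ^ 2)) + phaseIndex μ * Real.pi) := by
        rw [← this]
    _ = _ := by rw [Real.tan_add_nat_mul_pi, Real.tan_arctan]

/-- The radicand in the definition of `modeNorm`. -/
noncomputable def modeNormSq (μ : ℕ) (k : ℝ) : ℝ :=
  if Odd μ then 1 / 2 - Real.sin (2 * k) / (4 * k)
  else 1 / 2 + Real.sin (2 * k) / (4 * k) - (Real.sin k / k) ^ 2

theorem modeNorm_eq_sqrt (μ : ℕ) (k : ℝ) : modeNorm μ k = √(modeNormSq μ k) := by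
  unfold modeNorm modeNormSq
  split_ifs <;> rfl

theorem modeNormSq_pos {μ : ℕ} (hμ : 1 ≤ μ) {k : ℝ} (hk : μ * (Real.pi / 2) < k) :
    0 < modeNormSq μ k := by
  have hπ := Real.pi_gt_three
  have hμ' : (1 : ℝ) ≤ μ := by exact_mod_cast hμ
  have hk0 : 0 < k := lt_of_le_of_lt (by positivity) hk
  unfold modeNormSq
  split_ifs with h
  · have h1 := Real.sin_lt (show 0 < 2 * k by linarith)
    rw [sub_pos, div_lt_div_iff₀ (by linarith) two_pos]
    linarith
  · have h2 : (2 : ℝ) ≤ μ := by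
      obtain ⟨n, rfl⟩ := Nat.not_odd_iff_even.1 h
      exact_mod_cast (by omega : 2 ≤ n + n)
    have hk3 : 3 < k := by nlinarith
    have h3 : -(1 / 12) ≤ Real.sin (2 * k) / (4 * k) := by
      rw [le_div_iff₀ (by linarith)]
      linarith [Real.neg_one_le_sin (2 * k)]
    have h4 : (Real.sin k / k) ^ 2 ≤ 1 / 9 := by
      rw [div_pow, div_le_iff₀ (by positivity)]
      nlinarith [Real.sin_sq_le_one k]
    linarith

theorem integral_centeredMode (μ : ℕ) {k : ℝ} (hk : k ≠ 0) :
    ∫ x in (-1 : ℝ)..1, centeredMode μ k x = 0 := by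
  unfold centeredMode
  split_ifs
  · rw [intervalIntegral.integral_eq_sub_of_hasDerivAt (f := fun x => -Real.cos (k * x) / k)]
    · simp
    · intro x _
      have h := (((hasDerivAt_id x).const_mul k).cos.neg).div_const k
      refine h.congr_deriv ?_
      simp
      field_simp
    · exact Continuous.intervalIntegrable (by fun_prop) _ _
  · rw [intervalIntegral.integral_eq_sub_of_hasDerivAt
      (f := fun x => Real.sin (k * x) / k - Real.sin k / k * x)]
    · simp
      ring
    · intro x _
      have h := (((hasDerivAt_id x).const_mul k).sin.div_const k).sub
        ((hasDerivAt_id x).const_mul (Real.sin k / k))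
      refine h.congr_deriv ?_
      simp
      field_simp
    · exact Continuous.intervalIntegrable (by fun_prop) _ _

theorem integral_centeredMode_sq (μ : ℕ) {k : ℝ} (hk : k ≠ 0) :
    (1 / 2) * ∫ x in (-1 : ℝ)..1, centeredMode μ k x ^ 2 = modeNormSq μ k := by
  unfold centeredMode modeNormSq
  split_ifs
  · rw [intervalIntegral.integral_eq_sub_of_hasDerivAt
      (f := fun x => x / 2 - Real.sin (2 * (k * x)) / (4 * k))]
    · simp
      ring
    · intro x _
      have h := ((hasDerivAt_id x).div_const 2).sub
        ((((hasDerivAt_id x).const_mul k).const_mul 2).sin.div_const (4 * k))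
      refine h.congr_deriv ?_
      simp [Real.sin_sq_eq_half_sub]
      field_simp
      ring
    · exact Continuous.intervalIntegrable (by fun_prop) _ _
  · rw [intervalIntegral.integral_eq_sub_of_hasDerivAt
      (f := fun x => x / 2 + Real.sin (2 * (k * x)) / (4 * k)
        - 2 * (Real.sin k / k) * (Real.sin (k * x) / k) + (Real.sin k / k) ^ 2 * x)]
    · simp
      ring
    · intro x _
      have h := ((((hasDerivAt_id x).div_const 2).add
        ((((hasDerivAt_id x).const_mul k).const_mul 2).sin.div_const (4 * k))).sub
        ((((hasDerivAt_id x).const_mul k).sin.div_const k).const_mul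
          (2 * (Real.sin k / k)))).add ((hasDerivAt_id x).const_mul ((Real.sin k / k) ^ 2))
      refine h.congr_deriv ?_
      simp [sub_sq, Real.cos_sq]
      field_simp
      ring
    · exact Continuous.intervalIntegrable (by fun_prop) _ _

/-! ### Joint limits in the lattice size and the frequency -/

open Filter Topology

/-- The ratio `exp (-2 / (σ L))` of the kernel values at neighbouring sites of the lattice. -/
noncomputable def latticeRatio (σ : ℝ) (L : ℕ) : ℝ := Real.exp (-(2 / (σ * L)))

theorem latticeRatio_pos (σ : ℝ) (L : ℕ) : 0 < latticeRatio σ L := Real.exp_pos _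

theorem latticeRatio_lt_one {σ : ℝ} (hσ : 0 < σ) {L : ℕ} (hL : L ≠ 0) : latticeRatio σ L < 1 := by
  have : (0 : ℝ) < L := by exact_mod_cast Nat.pos_of_ne_zero hL
  rw [latticeRatio, Real.exp_lt_one_iff]
  exact neg_lt_zero.2 (by positivity)

section Asymptotics

variable {α : Type*} {F : Filter α} {N : α → ℕ} {t : α → ℝ} {k : ℝ}

theorem tendsto_div_natCast (hN : Tendsto N F atTop) (ht : Tendsto t F (𝓝 k)) :
    Tendsto (fun a => t a / N a) F (𝓝 0) :=
  ht.div_atTop (tendsto_natCast_atTop_atTop.comp hN)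

theorem tendsto_natCast_mul_sin_div (hN : Tendsto N F atTop) (ht : Tendsto t F (𝓝 k)) :
    Tendsto (fun a => N a * Real.sin (t a / N a)) F (𝓝 k) := by
  have h := ht.mul ((Real.continuous_sinc.tendsto 0).comp (tendsto_div_natCast hN ht))
  rw [Real.sinc_zero, mul_one] at h
  refine h.congr' ?_
  filter_upwards [hN.eventually_ne_atTop 0] with a ha
  have ha' : (N a : ℝ) ≠ 0 := by exact_mod_cast ha
  by_cases h0 : t a = 0
  · simp [h0]
  · simp only [Function.comp, Real.sinc_of_ne_zero (div_ne_zero h0 ha')]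
    field_simp

theorem tendsto_cos_div (hN : Tendsto N F atTop) (ht : Tendsto t F (𝓝 k)) :
    Tendsto (fun a => Real.cos (t a / N a)) F (𝓝 1) := by
  have := (Real.continuous_cos.tendsto 0).comp (tendsto_div_natCast hN ht)
  rwa [Real.cos_zero] at this

theorem tendsto_latticeRatio (σ : ℝ) (hN : Tendsto N F atTop) :
    Tendsto (fun a => latticeRatio σ (N a)) F (𝓝 1) := by
  have h := (tendsto_div_natCast hN (tendsto_const_nhds (x := 2 / σ))).neg
  have := (Real.continuous_exp.tendsto _).comp h
  rw [neg_zero, Real.exp_zero] at this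
  refine this.congr fun a => ?_
  simp only [Function.comp, latticeRatio, div_div]

theorem tendsto_natCast_mul_one_sub_latticeRatio (σ : ℝ)
    (hN : Tendsto N F atTop) :
    Tendsto (fun a => N a * (1 - latticeRatio σ (N a))) F (𝓝 (2 / σ)) := by
  have hd : HasDerivAt (fun x => -Real.exp (-(2 / σ * x))) (2 / σ) 0 := by
    have h := (((hasDerivAt_id (0 : ℝ)).const_mul (2 / σ)).neg.exp).neg
    refine h.congr_deriv ?_
    simp
  have h1 : Tendsto (fun a => ((N a : ℝ))⁻¹) F (𝓝[≠] 0) := by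
    refine tendsto_nhdsWithin_iff.2 ⟨tendsto_inv_atTop_zero.comp
      (tendsto_natCast_atTop_atTop.comp hN), ?_⟩
    filter_upwards [hN.eventually_ne_atTop 0] with a ha
    simpa using ha
  refine ((hasDerivAt_iff_tendsto_slope.1 hd).comp h1).congr fun a => ?_
  simp only [Function.comp, slope_def_field, latticeRatio]
  rw [mul_zero, neg_zero, Real.exp_zero, sub_zero, div_inv_eq_mul, ← div_eq_mul_inv, div_div]
  ring

theorem tendsto_sq_mul_denominator (σ : ℝ) (hN : Tendsto N F atTop)
    (ht : Tendsto t F (𝓝 k)) :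
    Tendsto (fun a => (N a : ℝ) ^ 2 * ((1 - latticeRatio σ (N a)) ^ 2 +
      4 * latticeRatio σ (N a) * Real.sin (t a / N a) ^ 2)) F (𝓝 ((2 / σ) ^ 2 + 4 * k ^ 2)) := by
  have h := ((tendsto_natCast_mul_one_sub_latticeRatio σ hN).pow 2).add
    (((tendsto_latticeRatio σ hN).const_mul 4).mul ((tendsto_natCast_mul_sin_div hN ht).pow 2))
  rw [mul_one] at h
  exact h.congr fun a => by ring

theorem tendsto_quantizationDefect {σ : ℝ} (hσ : 0 < σ) (μ : ℕ) (hN : Tendsto N F atTop)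
    (ht : Tendsto t F (𝓝 k)) :
    Tendsto (fun a => (N a : ℝ) ^ (if Odd μ then 1 else 2) *
      quantizationDefect (latticeRatio σ (N a)) (N a) μ (t a)) F (𝓝 (limitDefect σ μ k)) := by
  have hr := tendsto_latticeRatio σ hN
  have hr' := tendsto_natCast_mul_one_sub_latticeRatio σ hN
  have hs := tendsto_natCast_mul_sin_div hN ht
  have hc := tendsto_cos_div hN ht
  have hS := (Real.continuous_sin.tendsto k).comp ht
  have hC := (Real.continuous_cos.tendsto k).comp ht
  unfold quantizationDefect limitDefect
  split_ifs
  · have h := ((hS.mul hc).mul hr').add ((hC.mul hs).mul (hr.const_add 1))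
    refine (h.congr fun a => ?_).trans_eq ?_
    · simp only [Function.comp]; ring
    · congr 1; field_simp; ring
  · have h := ((hr'.mul hs).mul (((hC.mul hc).mul hr').sub ((hS.mul hs).mul
      (hr.const_add 1)))).sub (hS.mul (tendsto_sq_mul_denominator σ hN ht))
    refine (h.congr fun a => ?_).trans_eq ?_
    · simp only [Function.comp]; ring
    · congr 1; field_simp; ring

theorem tendsto_toeplitzSymbol {σ : ℝ} (hσ : 0 < σ) (hN : Tendsto N F atTop)
    (ht : Tendsto t F (𝓝 k)) :
    Tendsto (fun a => 2 / N a * toeplitzSymbol (latticeRatio σ (N a)) (t a / N a)) F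
      (𝓝 (2 * σ / (1 + σ ^ 2 * k ^ 2))) := by
  have h := (((tendsto_natCast_mul_one_sub_latticeRatio σ hN).mul
    ((tendsto_latticeRatio σ hN).const_add 1)).const_mul 2).div
    (tendsto_sq_mul_denominator σ hN ht) (by positivity)
  refine (h.congr' ?_).trans_eq ?_
  · filter_upwards [hN.eventually_ne_atTop 0] with a ha
    have ha' : (N a : ℝ) ≠ 0 := by exact_mod_cast ha
    simp only [Pi.div_apply, toeplitzSymbol]
    rw [div_mul_div_comm, ← mul_div_mul_left (2 * (1 - latticeRatio σ (N a) ^ 2)) _ ha']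
    congr 1 <;> ring
  · congr 1; field_simp; ring

theorem tendsto_sum_latticeMode_sq (μ : ℕ) (hk : k ≠ 0) (hN : Tendsto N F atTop)
    (ht : Tendsto t F (𝓝 k)) :
    Tendsto (fun a => (∑ j ∈ Finset.range (N a), latticeMode (N a) μ (t a) j ^ 2) / N a) F
      (𝓝 (modeNormSq μ k)) := by
  have hs := tendsto_natCast_mul_sin_div hN ht
  have hs2 := tendsto_natCast_mul_sin_div hN (ht.const_mul 2)
  have hk2 : 2 * k ≠ 0 := mul_ne_zero two_ne_zero hk
  have hS := (Real.continuous_sin.tendsto k).comp ht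
  have hS2 := ((Real.continuous_sin.tendsto (2 * k)).comp (ht.const_mul 2)).div
    (hs2.const_mul 2) (mul_ne_zero two_ne_zero hk2)
  have h : Tendsto (fun a =>
      if Odd μ then 1 / 2 - Real.sin (2 * t a) / (2 * (N a * Real.sin (2 * t a / N a)))
      else 1 / 2 + Real.sin (2 * t a) / (2 * (N a * Real.sin (2 * t a / N a))) -
        (Real.sin (t a) / (N a * Real.sin (t a / N a))) ^ 2) F (𝓝 (modeNormSq μ k)) := by
    unfold modeNormSq
    rw [show 4 * k = 2 * (2 * k) by ring]
    split_ifs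
    · exact hS2.const_sub _
    · exact (hS2.const_add _).sub ((hS.div hs hk).pow 2)
  refine h.congr' ?_
  filter_upwards [hs.eventually_ne hk, hs2.eventually_ne hk2] with a h1 h2
  refine (sum_latticeMode_sq ?_ μ (right_ne_zero_of_mul h1) (right_ne_zero_of_mul h2)).symm
  exact_mod_cast left_ne_zero_of_mul h1

end Asymptotics

/-! ### Comparison of the lattice with the continuum -/

/-- Every neighbourhood of the solution of the limiting quantization condition contains zeros of
the quantization defects of all large lattices. -/
theorem eventually_exists_quantizationDefect_eq_zero {σ : ℝ} (hσ : 0 < σ) {μ : ℕ} (hμ : 1 ≤ μ)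
    {k : ℝ} (hk0 : 0 < k) (hk : k = quantizationRHS σ μ k) {U : Set ℝ} (hU : U ∈ 𝓝 k) :
    ∀ᶠ L : ℕ in atTop, ∃ θ ∈ U,
      θ ∈ Set.Ioo (μ * (Real.pi / 2)) ((μ + 1) * (Real.pi / 2)) ∧
        quantizationDefect (latticeRatio σ L) L μ θ = 0 := by
  have hmem := mem_Ioo_of_eq_quantizationRHS hσ hk0 hk
  have hμ' : (1 : ℝ) ≤ μ := by exact_mod_cast hμ
  obtain ⟨δ, hδ, hδU⟩ := Metric.nhds_basis_closedBall.mem_iff.1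
    (inter_mem hU (Ioo_mem_nhds hmem.1 hmem.2))
  rw [Real.closedBall_eq_Icc] at hδU
  have ha := (hδU ⟨le_rfl, by linarith⟩).2
  have hb := (hδU ⟨by linarith, le_rfl⟩).2
  have ha0 : 0 < k - δ := lt_of_le_of_lt (by positivity) ha.1
  have hneg := limitDefect_mul_neg hσ hk ha.1.le ha0 (by linarith) (by linarith) hb.2.le
  have hlim := (tendsto_quantizationDefect hσ μ tendsto_id
    (tendsto_const_nhds (x := k - δ))).mul (tendsto_quantizationDefect hσ μ tendsto_id
    (tendsto_const_nhds (x := k + δ)))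
  filter_upwards [hlim.eventually_lt_const hneg] with L hL
  obtain ⟨θ, hθ, hθ0⟩ := exists_Ioo_eq_zero
    (continuous_quantizationDefect (latticeRatio σ L) L μ)
    (show k - δ < k + δ by linarith) (by
      by_contra hcon
      refine absurd hL (not_lt.2 ?_)
      have := mul_nonneg (sq_nonneg ((L : ℝ) ^ (if Odd μ then 1 else 2))) (not_lt.1 hcon)
      simp only [id]
      linear_combination this)
  exact ⟨θ, (hδU ⟨hθ.1.le, hθ.2.le⟩).1, (hδU ⟨hθ.1.le, hθ.2.le⟩).2, hθ0⟩

theorem abs_centeredMode_le (μ : ℕ) (k x : ℝ) : |centeredMode μ k x| ≤ 1 + |Real.sin k / k| := by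
  unfold centeredMode
  split_ifs
  · linarith [Real.abs_sin_le_one (k * x), abs_nonneg (Real.sin k / k)]
  · linarith [abs_sub (Real.cos (k * x)) (Real.sin k / k), Real.abs_cos_le_one (k * x)]

/-- The lattice mode is uniformly close to the continuum mode. The lattice coordinate
`2 (j - ⌊L / 2⌋) / L` differs by at most `1 / L` from the coordinate `(2 j - L + 1) / L` measured
from the midpoint of the lattice. -/
theorem abs_latticeMode_sub_centeredMode_le {L : ℕ} (μ : ℕ) (θ : ℝ) {k : ℝ} (hk : 0 < k) {j : ℕ}
    (hj : j < L) :
    |latticeMode L μ θ j - centeredMode μ k (latticeCoord L (j - (L / 2 : ℕ)))| ≤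
      |θ - k| + k / L + |Real.sin θ / (L * Real.sin (θ / L)) - Real.sin k / k| := by
  have hL : (0 : ℝ) < L := by exact_mod_cast (by omega : 0 < L)
  have hjL : (j : ℝ) + 1 ≤ L := by exact_mod_cast hj
  have hj0 : (0 : ℝ) ≤ j := j.cast_nonneg
  set x' : ℝ := (2 * j - L + 1) / L with hx'
  set x : ℝ := latticeCoord L (j - (L / 2 : ℕ)) with hx
  have h1 : |x'| ≤ 1 := by
    rw [abs_le, hx', le_div_iff₀ hL, div_le_iff₀ hL]
    constructor <;> linarith
  have h2 : |x' - x| ≤ 1 / L := by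
    have e : x' - x = (2 * (L / 2 : ℕ) + 1 - L) / L := by
      rw [hx, hx', latticeCoord]
      simp only [Int.cast_sub, Int.cast_natCast]
      field_simp
      ring
    have l1 : (2 * (L / 2 : ℕ) : ℝ) ≤ L := by exact_mod_cast (by omega : 2 * (L / 2) ≤ L)
    have l2 : (L : ℝ) ≤ 2 * (L / 2 : ℕ) + 1 := by exact_mod_cast (by omega : L ≤ 2 * (L / 2) + 1)
    rw [e, abs_div, abs_of_pos hL]
    exact div_le_div_of_nonneg_right (abs_le.2 ⟨by linarith, by linarith⟩) hL.le
  have harg : 2 * (θ / L) * j - (L - 1) * (θ / L) = θ * x' := by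
    rw [hx']; field_simp; ring
  have h3 : |θ * x' - k * x| ≤ |θ - k| + k / L := by
    have e : θ * x' - k * x = (θ - k) * x' + k * (x' - x) := by ring
    rw [e]
    refine (abs_add_le _ _).trans (add_le_add ?_ ?_)
    · rw [abs_mul]
      exact mul_le_of_le_one_right (abs_nonneg _) h1
    · rw [abs_mul, abs_of_pos hk, div_eq_mul_one_div]
      exact mul_le_mul_of_nonneg_left h2 hk.le
  unfold latticeMode centeredMode
  rw [harg]
  split_ifs
  · have := Real.abs_sin_sub_sin_le (θ * x') (k * x)
    linarith [abs_nonneg (Real.sin θ / (L * Real.sin (θ / L)) - Real.sin k / k)]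
  · have := Real.abs_cos_sub_cos_le (θ * x') (k * x)
    rw [sub_sub_sub_comm]
    linarith [abs_sub (Real.cos (θ * x') - Real.cos (k * x))
      (Real.sin θ / (L * Real.sin (θ / L)) - Real.sin k / k)]

/-- The centered index set, shifted by `⌊L / 2⌋`, is `{0, …, L - 1}`. -/
theorem mem_centeredIndexSet_iff {L : ℕ} (n : ℤ) :
    n ∈ centeredIndexSet L ↔ 0 ≤ n + (L / 2 : ℕ) ∧ n + (L / 2 : ℕ) < L := by
  unfold centeredIndexSet
  split_ifs with h
  · rw [Nat.even_iff] at h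
    simp only [Set.mem_Icc]
    omega
  · rw [Nat.not_even_iff] at h
    simp only [Set.mem_Icc]
    omega

theorem exists_equiv_fin_of_bijOn {V : Type*} {S : Finset V} {n : V → ℤ} {L : ℕ}
    (h : Set.BijOn n (S : Set V) (centeredIndexSet L)) :
    ∃ e : S ≃ Fin L, ∀ i : S, n i = ((e i : ℕ) : ℤ) - (L / 2 : ℕ) := by
  have hmem : ∀ i : S, 0 ≤ n i + (L / 2 : ℕ) ∧ n i + (L / 2 : ℕ) < L := fun i =>
    (mem_centeredIndexSet_iff _).1 (h.mapsTo i.2)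
  let f : S → Fin L := fun i => ⟨(n i + (L / 2 : ℕ)).toNat, by have := hmem i; omega⟩
  have hf : ∀ i : S, n i = ((f i : ℕ) : ℤ) - (L / 2 : ℕ) := fun i => by
    have := hmem i
    simp only [f]
    omega
  have hbij : Function.Bijective f := by
    constructor
    · intro i j hij
      apply Subtype.ext
      apply h.injOn i.2 j.2
      rw [hf i, hf j, hij]
    · intro j
      obtain ⟨v, hv, hvj⟩ := h.surjOn
        ((mem_centeredIndexSet_iff ((j : ℤ) - (L / 2 : ℕ))).2 (by have := j.2; omega))
      refine ⟨⟨v, hv⟩, Fin.ext ?_⟩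
      have := hf ⟨v, hv⟩
      simp only at this
      omega
  exact ⟨Equiv.ofBijective f hbij, hf⟩

/-- The kernel `exp (-|x - y| / σ)` on the lattice is a power of `latticeRatio σ L`; the exponent
`a - b + (b - a)`, in truncated subtraction, is the distance of the sites. -/
theorem exp_latticeCoord {σ : ℝ} (L : ℕ) (s a b : ℕ) :
    Real.exp (-|(|latticeCoord L (a - s) - latticeCoord L (b - s)|)| / σ) =
      latticeRatio σ L ^ (a - b + (b - a)) := by
  rw [latticeRatio, ← Real.exp_nat_mul, abs_abs]
  congr 1
  have h1 : latticeCoord L (a - s) - latticeCoord L (b - s) = 2 / L * ((a : ℝ) - b) := by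
    unfold latticeCoord
    push_cast
    ring
  have h2 : |(a : ℝ) - b| = (a - b + (b - a) : ℕ) := by
    rcases le_total a b with h | h
    · rw [abs_of_nonpos (by simpa using h), Nat.sub_eq_zero_of_le h, zero_add, Nat.cast_sub h]
      ring
    · rw [abs_of_nonneg (by simpa using h), Nat.sub_eq_zero_of_le h, add_zero, Nat.cast_sub h]
  rw [h1, abs_mul, h2, abs_of_nonneg (by positivity)]
  field_simp

theorem centeredEmbedding_mul_transpose {V : Type*} [DecidableEq V] {d : ℕ}
    (S : Finset V) (W : Matrix V (Fin d) ℝ) :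
    centeredEmbedding S W * (centeredEmbedding S W)ᵀ = centeringMatrix S *
      (Matrix.of fun i j : S => ∑ m, W i m * W j m) * centeringMatrix S := by
  rw [centeredEmbedding, transpose_mul, centeringMatrix_transpose, Matrix.mul_assoc,
    ← Matrix.mul_assoc (W.submatrix _ _), ← Matrix.mul_assoc]
  rfl

theorem proposition2 (σ : ℝ) (hσ : 0 < σ) :
    (∀ μ : ℕ, 1 ≤ μ → ∃! k : ℝ, 0 < k ∧ k = quantizationRHS σ μ k) ∧
    ∀ k : ℕ → ℝ, (∀ μ : ℕ, 1 ≤ μ → 0 < k μ ∧ k μ = quantizationRHS σ μ (k μ)) →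
      ∀ μ : ℕ, 1 ≤ μ →
        k μ < k (μ + 1) ∧
        (Odd μ → Real.tan (k μ) = -σ * k μ) ∧
        (Even μ → Real.tan (k μ) = k μ / (1 + σ * (1 + σ) * k μ ^ 2)) ∧
        0 < modeNorm μ (k μ) ∧
        0 < modeAmplitude σ (k μ) ∧
        (∫ x in (-1 : ℝ)..1, centeredMode μ (k μ) x) = 0 ∧
        (1 / 2) * (∫ x in (-1 : ℝ)..1, centeredMode μ (k μ) x ^ 2) = modeNorm μ (k μ) ^ 2 ∧
        ∀ ε : ℝ, 0 < ε → ∀ᶠ L : ℕ in Filter.atTop,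
          ∀ (V : Type*) [Fintype V] [DecidableEq V] (P : Matrix V V ℝ) (S : Finset V)
            (n : V → ℤ) (d : ℕ) (W : Matrix V (Fin d) ℝ)
            (Wbar : Matrix S (Fin (min (Fintype.card S) d)) ℝ),
            Set.BijOn n (S : Set V) (centeredIndexSet L) →
            (TranslationSymmetric P S (fun i => latticeCoord L (n i))
                (fun Δ => Real.exp (-|Δ| / σ)) ∨
              AbsTranslationSymmetric P S (fun i => latticeCoord L (n i))
                (fun Δ => Real.exp (-|Δ| / σ))) →
            (normalizedCooccurrence P).rank ≤ d →
            IsWordEmbedding (normalizedCooccurrence P) d W →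
            IsPCAProjection (centeredEmbedding S W) Wbar →
            ∃ (hμ : μ - 1 < min (Fintype.card S) d) (s : ℝ), (s = 1 ∨ s = -1) ∧
              (∀ i : S,
                |√(L : ℝ) * (√(2 / (L : ℝ)) * Wbar i ⟨μ - 1, hμ⟩) -
                  s * (modeAmplitude σ (k μ) *
                    (centeredMode μ (k μ) (latticeCoord L (n i)) / modeNorm μ (k μ)))| < ε) ∧
              |√(∑ i : S, (√(2 / (L : ℝ)) * Wbar i ⟨μ - 1, hμ⟩) ^ 2) -
                modeAmplitude σ (k μ)| < ε := by
  refine ⟨fun μ hμ => existsUnique_eq_quantizationRHS hσ hμ, fun k hk μ hμ => ?_⟩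
  obtain ⟨hk0, hkμ⟩ := hk μ hμ
  have hmem := mem_Ioo_of_eq_quantizationRHS hσ hk0 hkμ
  have hmem' := mem_Ioo_of_eq_quantizationRHS hσ (hk (μ + 1) (by omega)).1 (hk (μ + 1) (by omega)).2
  have hNsq := modeNormSq_pos hμ hmem.1
  refine ⟨hmem.2.trans (by simpa using hmem'.1), tan_of_odd hkμ, tan_of_even hkμ, ?_, ?_,
    integral_centeredMode μ hk0.ne', ?_, fun ε hε => ?_⟩
  · rw [modeNorm_eq_sqrt]
    exact Real.sqrt_pos.2 hNsq
  · exact Real.sqrt_pos.2 (by positivity)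
  · rw [integral_centeredMode_sq μ hk0.ne', modeNorm_eq_sqrt, Real.sq_sqrt hNsq.le]
  clear hmem' hk
  generalize k μ = κ at *
  have hN : Tendsto Prod.fst (atTop ×ˢ 𝓝 κ : Filter (ℕ × ℝ)) atTop := tendsto_fst
  have ht : Tendsto Prod.snd (atTop ×ˢ 𝓝 κ : Filter (ℕ × ℝ)) (𝓝 κ) := tendsto_snd
  -- limits as `L → ∞` and `θ → κ` jointly: a zero `θ` of the defect is chosen only at the end
  have hamp : Tendsto (fun p : ℕ × ℝ =>
      √(2 / p.1 * toeplitzSymbol (latticeRatio σ p.1) (p.2 / p.1))) (atTop ×ˢ 𝓝 κ)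
      (𝓝 (modeAmplitude σ κ)) :=
    (Real.continuous_sqrt.tendsto _).comp (tendsto_toeplitzSymbol hσ hN ht)
  have hnorm : Tendsto (fun p : ℕ × ℝ =>
      √((∑ j ∈ Finset.range p.1, latticeMode p.1 μ p.2 j ^ 2) / p.1)) (atTop ×ˢ 𝓝 κ)
      (𝓝 (modeNorm μ κ)) := by
    rw [modeNorm_eq_sqrt]
    exact (Real.continuous_sqrt.tendsto _).comp (tendsto_sum_latticeMode_sq μ hk0.ne' hN ht)
  have hratio := hamp.div hnorm (by rw [modeNorm_eq_sqrt]; exact (Real.sqrt_pos.2 hNsq).ne')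
  have hmode : Tendsto (fun p : ℕ × ℝ => |p.2 - κ| + κ / p.1 +
      |Real.sin p.2 / (p.1 * Real.sin (p.2 / p.1)) - Real.sin κ / κ|) (atTop ×ˢ 𝓝 κ) (𝓝 0) := by
    have h1 := ((ht.sub_const κ).abs.add
      (tendsto_div_natCast hN (tendsto_const_nhds (x := κ)))).add
      ((((Real.continuous_sin.tendsto κ).comp ht).div (tendsto_natCast_mul_sin_div hN ht)
        hk0.ne').sub_const (Real.sin κ / κ)).abs
    simpa using h1
  have herr := (hratio.abs.mul hmode).add ((hratio.sub_const
    (modeAmplitude σ κ / modeNorm μ κ)).abs.mul_const (1 + |Real.sin κ / κ|))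
  simp only [mul_zero, sub_self, abs_zero, zero_mul, add_zero] at herr
  have hev := (herr.eventually_lt_const hε).and
    ((hamp.sub_const (modeAmplitude σ κ)).abs.eventually_lt_const (by simpa using hε))
  obtain ⟨p, hp, q, hq, hpq⟩ := eventually_prod_iff.1 hev
  filter_upwards [hp, eventually_exists_quantizationDefect_eq_zero hσ hμ hk0 hkμ hq,
    eventually_ge_atTop 3, eventually_gt_atTop μ] with L hpL hroot hL3 hμL
  obtain ⟨θ, hqθ, hθ, hF⟩ := hroot
  obtain ⟨herrL, hampL⟩ := hpq hpL hqθ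
  intro V _ _ P S n d W Wbar hn hsymm hrank hW hWbar
  have hLpos : (0 : ℝ) < L := by exact_mod_cast (by omega : 0 < L)
  obtain ⟨e, he⟩ := exists_equiv_fin_of_bijOn hn
  obtain ⟨Mp, Mm, Cp, Cm, hMp, hMm, hM, hM0, hMS⟩ :=
    hsymm.elim TranslationSymmetric.abs id
  have hWW := hW.mul_transpose hrank hMp hMm hM hM0
  obtain ⟨h, s, hs, hcol, hsum⟩ := hWbar.exists_column_eq_latticeMode hL3 e
    (latticeRatio_pos σ L) (latticeRatio_lt_one hσ (by omega))
    (K := Matrix.of fun i j : S => ∑ m, W i m * W j m)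
    (fun i j => by
      obtain ⟨h1, h2, h3⟩ := hMS i i.2 j j.2
      have h4 := congrFun (congrFun hWW i) j
      rw [Matrix.add_apply, h1, h2, h3] at h4
      beta_reduce at h4
      rw [he, he] at h4
      exact h4.trans (exp_latticeCoord L (L / 2) (e i) (e j)))
    (centeredEmbedding_mul_transpose S W) hμ hμL hθ hF
  refine ⟨h, s, hs, fun i => ?_, ?_⟩
  · have hbound := abs_latticeMode_sub_centeredMode_le μ θ hk0 (e i).2
    rw [hcol, he]
    set v := latticeMode L μ θ (e i : ℕ)
    set φ := centeredMode μ κ (latticeCoord L ((e i : ℕ) - (L / 2 : ℕ)))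
    set R := √(2 / L * toeplitzSymbol (latticeRatio σ L) (θ / L)) /
      √((∑ j ∈ Finset.range L, latticeMode L μ θ j ^ 2) / L) with hR
    have hφ : |φ| ≤ 1 + |Real.sin κ / κ| := abs_centeredMode_le _ _ _
    have e1 : √(L : ℝ) * (√(2 / (L : ℝ)) * (s * (√(toeplitzSymbol (latticeRatio σ L) (θ / L)) *
        (v / √(∑ j ∈ Finset.range L, latticeMode L μ θ j ^ 2))))) = s * (R * v) := by
      rw [hR, Real.sqrt_mul (by positivity), Real.sqrt_div' (∑ j ∈ Finset.range L, _) hLpos.le,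
        div_div_eq_mul_div]
      ring
    have e2 : s * (R * v) - s * (modeAmplitude σ κ * (φ / modeNorm μ κ)) =
        s * (R * (v - φ) + (R - modeAmplitude σ κ / modeNorm μ κ) * φ) := by ring
    have hs1 : |s| = 1 := by rcases hs with rfl | rfl <;> simp
    rw [e1, e2, abs_mul, hs1, one_mul]
    refine lt_of_le_of_lt ((abs_add_le _ _).trans (add_le_add ?_ ?_)) herrL
    · rw [abs_mul]
      exact mul_le_mul_of_nonneg_left hbound (abs_nonneg _)
    · rw [abs_mul]
      exact mul_le_mul_of_nonneg_left hφ (abs_nonneg _)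
  · simp only [mul_pow, ← Finset.mul_sum, hsum]
    rw [Real.sq_sqrt (by positivity)]
    exact hampL
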